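/- Let $(X,\mathcal B,\mu)$ be a standard (Lebesgue) probability space and let $T$ be a weakly mixing automorphism of it, i.e. an invertible measure-preserving transformation such that $T\times T$ is ergodic for $\mu\otimes\mu$. A joining of $n$ copies of $T$ is a $T\times\dots\times T$-invariant probability measure on $X^n$ all of whose one-dimensional projections are $\mu$; write $\pi_{ij}\nu$ for the projection of $\nu$ to the face $X_i\times X_j$. Definitions. $T$ has the hereditary independence (HI) property if every ergodic joining $\eta$ of three copies of $T$ with $\pi_{12}\eta=\mu\otimes\mu$ and $\pi_{13}\eta=\mu\otimes\mu$ satisfies $\eta=\mu\otimes\pi_{23}\eta$. $T$ is tensor simple if for every $n\ge 3$ the only joining $\nu$ (ergodic or not) of $n$ copies of $T$ with $\pi_{ij}\nu=\mu\otimes\mu$ for all $i<j$ is $\nu=\mu^{\otimes n}$. A measure $\nu$ on $X\times X$ with both projections equal to $\mu$ is quasi-diagonal if there are integers $p,q\ge 1$ such that in the disintegrations $\nu(A\times B)=\int_A\nu_x(B)\,d\mu(x)=\int_B\nu_y(A)\,d\mu(y)$ almost every $\nu_x$ is the uniform probability measure on $p$ distinct points and almost every $\nu_y$ is the uniform probability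 measure on $q$ distinct points. $T$ is quasi-simple of order $n$ (respectively simple of order $n$) if every ergodic joining $\nu\ne\mu^{\otimes n}$ of $n$ copies of $T$ has a two-dimensional projection $\pi_{ij}\nu$, $i<j$, that is quasi-diagonal (respectively that is the image of $\mu$ under $x\mapsto(x,Sx)$ for some automorphism $S$ of $(X,\mu)$ commuting with $T$). Theorem. (1) If $T$ has the HI property, then $T$ is tensor simple. (2) If $T$ is quasi-simple of order $3$, then $T$ has the HI property. (3) $T$ is quasi-simple of order $3$ if and only if $T$ is quasi-simple of every order $n\ge 2$. (4) If $T$ is simple of order $3$, then $T$ is simple of every order $n\ge 2$. -/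

import Mathlib

open MeasureTheory ProbabilityTheory
open scoped ENNReal

namespace ErgodicJoinings

variable {X : Type*} [MeasurableSpace X]

/-- The diagonal action `T × ⋯ × T` on the cube `Xⁿ`. -/
def cubeMap (T : X → X) (n : ℕ) : (Fin n → X) → (Fin n → X) :=
  fun x i => T (x i)

/-- The projection of a measure on the cube `Xⁿ` to the two-dimensional face `X_i × X_j`. -/
noncomputable def face {n : ℕ} (ν : Measure (Fin n → X)) (i j : Fin n) : Measure (X × X) :=
  ν.map (fun x => (x i, x j))

/-- `T` is weakly mixing: the only `T × T`-invariant functions are the constants, i.e.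
`T × T` is ergodic with respect to `μ ⊗ μ`. -/
def IsWeaklyMixing (μ : Measure X) (T : X → X) : Prop :=
  Ergodic (Prod.map T T) (μ.prod μ)

/-- `ν` is a joining of `n` copies of `(X, μ, T)`: a probability measure on `Xⁿ` invariant
under `T × ⋯ × T`, all of whose one-dimensional projections are `μ`. -/
structure IsJoining (μ : Measure X) (T : X → X) {n : ℕ} (ν : Measure (Fin n → X)) : Prop where
  isProbabilityMeasure : IsProbabilityMeasure ν
  measurePreserving : MeasurePreserving (cubeMap T n) ν ν
  marginal : ∀ i, ν.map (fun x => x i) = μ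

/-- An ergodic joining of `n` copies of `(X, μ, T)`. -/
structure IsErgodicJoining (μ : Measure X) (T : X → X) {n : ℕ} (ν : Measure (Fin n → X)) :
    Prop extends IsJoining μ T ν where
  ergodic : Ergodic (cubeMap T n) ν

/-- The uniform probability measure on the points `y 0, …, y (p - 1)`:
`(1 / p) (δ_{y 0} + ⋯ + δ_{y (p - 1)})`. -/
noncomputable def uniformOnPoints {p : ℕ} (y : Fin p → X) : Measure X :=
  (p : ℝ≥0∞)⁻¹ • ∑ i, Measure.dirac (y i)

/-- In the disintegration `ν(A × B) = ∫_A ν_x(B) dμ(x)`, almost every conditional measure `ν_x`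
is the uniform probability measure on `p` distinct points, where `p ≥ 1` does not depend
on `x`. -/
def HasUniformFibres (μ : Measure X) (ν : Measure (X × X)) (p : ℕ) : Prop :=
  0 < p ∧ ∃ κ : Kernel X X, IsMarkovKernel κ ∧ ν = μ.compProd κ ∧
    ∀ᵐ x ∂μ, ∃ y : Fin p → X, Function.Injective y ∧ κ x = uniformOnPoints y

/-- `ν` is quasi-diagonal: both families of conditional measures are, almost everywhere, uniform
on finitely many points (`p` points in one direction and `q` points in the other). -/
def IsQuasiDiagonal (μ : Measure X) (ν : Measure (X × X)) : Prop :=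
  ∃ p q : ℕ, HasUniformFibres μ ν p ∧ HasUniformFibres μ (ν.map Prod.swap) q

/-- `T` is quasi-simple of order `n`: every ergodic joining of `n` copies of `T` other than
`μ^{⊗ n}` has a quasi-diagonal projection to some two-dimensional face. -/
def IsQuasiSimple (μ : Measure X) (T : X → X) (n : ℕ) : Prop :=
  ∀ ν : Measure (Fin n → X), IsErgodicJoining μ T ν → ν ≠ Measure.pi (fun _ => μ) →
    ∃ i j : Fin n, i < j ∧ IsQuasiDiagonal μ (face ν i j)

/-- `ν` is the shifted diagonal measure `Δ_S = (Id × S) Δ` for some automorphism `S`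
commuting with `T`. -/
def IsShiftedDiagonal (μ : Measure X) (T : X → X) (ν : Measure (X × X)) : Prop :=
  ∃ S : X ≃ᵐ X, MeasurePreserving S μ μ ∧ (∀ᵐ x ∂μ, S (T x) = T (S x)) ∧
    ν = μ.map (fun x => (x, S x))

/-- `T` is simple of order `n`: every ergodic joining of `n` copies of `T` other than
`μ^{⊗ n}` has a shifted diagonal measure as its projection to some two-dimensional face. -/
def IsSimpleOfOrder (μ : Measure X) (T : X → X) (n : ℕ) : Prop :=
  ∀ ν : Measure (Fin n → X), IsErgodicJoining μ T ν → ν ≠ Measure.pi (fun _ => μ) →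
    ∃ i j : Fin n, i < j ∧ IsShiftedDiagonal μ T (face ν i j)

/-- The hereditary independence property: for every ergodic joining `η` of three copies of `T`,
if the first coordinate is independent of the second and of the third, then it is
independent of the pair, i.e. `η = μ ⊗ π₂₃ η`. -/
def HasHI (μ : Measure X) (T : X → X) : Prop :=
  ∀ η : Measure (Fin 3 → X), IsErgodicJoining μ T η →
    face η 0 1 = μ.prod μ → face η 0 2 = μ.prod μ →
    η.map (fun x => (x 0, (x 1, x 2))) = μ.prod (face η 1 2)

/-- `T` is tensor simple: for every `n ≥ 3`, the product measure is the only joining (ergodic or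
not) of `n` copies of `T` that is pairwise independent. -/
def IsTensorSimple (μ : Measure X) (T : X → X) : Prop :=
  ∀ n : ℕ, 3 ≤ n → ∀ ν : Measure (Fin n → X), IsJoining μ T ν →
    (∀ i j : Fin n, i < j → face ν i j = μ.prod μ) → ν = Measure.pi (fun _ => μ)

end ErgodicJoinings

namespace ErgodicJoinings

/-! ### Degenerate systems and finite fibres -/

section Fibres

variable {X : Type*} [MeasurableSpace X]

/-! Quasi-simplicity of order three gives HI by absolute continuity. Let `η` be an ergodic joining
whose first coordinate is independent of each of the other two, with `π₂₃ η` quasi-diagonal. Given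
the second coordinate, the third is an atom of a finite fibre measure, so `η ≪ μ ⊗ π₂₃ η`
(`absolutelyContinuous_of_hasUniformFibres`). The right side is ergodic, because weakly mixing times
ergodic is ergodic (`ergodic_prodMap`); an invariant probability measure absolutely continuous with
respect to an ergodic one equals it.

HI gives tensor simplicity by induction on the number of coordinates. Grouping the middle ones into
one system `(Y, lam, R)` leaves the case of a joining of `(x, y, z)` with product two-dimensional
marginals (`HasHI.eq_prod_prod`). Let `K (x, y)` be the conditional law of `z`, and draw `z` from `K
(x, y)` and `z'` from `K (Tᵏ x, y)` independently. Then `x` is independent of `z` and of `z'`, hence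
by HI of the pair. So the vectors `Φ x = K (x, ·) B - μ B` of `L²(lam)` have correlations `⟪Φ x, Φ
(Tᵏ x)⟫` that do not depend on `x`, and they have mean zero. Weak mixing forces `Φ = 0`
(`ae_eq_zero_of_inner_iterate_const`): otherwise two points with nearby values of `Φ` can be moved,
at the same time `n`, one to a similar value and the other far away, which gives two different
correlations.

The law of `(x, z, z')` need not be ergodic. HI extends to it by ergodic decomposition, since the
ergodic measure `μ ⊗ μ` is extreme and almost all components inherit the marginals.

For higher orders, HI shows that a joining other than the product has a face other than `μ ⊗ μ`.
That face is an ergodic joining of order two, and adjoining an independent copy of `T` reduces it to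
order three. -/

theorem measurable_face {n : ℕ} (i j : Fin n) :
    Measurable fun x : Fin n → X => (x i, x j) := by fun_prop

theorem inv_le_uniformOnPoints_singleton [MeasurableSingletonClass X] {p : ℕ} (y : Fin p → X)
    (i : Fin p) : (p : ℝ≥0∞)⁻¹ ≤ uniformOnPoints y {y i} := by
  have h : (1 : ℝ≥0∞) ≤ (∑ j, Measure.dirac (y j)) {y i} := by
    rw [Measure.finsetSum_apply]
    calc (1 : ℝ≥0∞) = Measure.dirac (y i) {y i} := by simp
      _ ≤ _ := Finset.single_le_sum (f := fun j => Measure.dirac (y j) {y i})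
          (fun _ _ => zero_le) (Finset.mem_univ i)
  rw [uniformOnPoints, Measure.smul_apply, smul_eq_mul]
  calc (p : ℝ≥0∞)⁻¹ = (p : ℝ≥0∞)⁻¹ * 1 := (mul_one _).symm
    _ ≤ _ := by gcongr

theorem ae_uniformOnPoints_mem_range [MeasurableSingletonClass X] {p : ℕ} (y : Fin p → X) :
    ∀ᵐ z ∂(uniformOnPoints y), ∃ i, z = y i := by
  rw [ae_iff, uniformOnPoints, Measure.smul_apply, Measure.finsetSum_apply]
  simp

/-- If `μ ⊗ μ` has finite fibres, then `μ` is a point mass. -/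
theorem exists_ae_eq_of_hasUniformFibres_prod [StandardBorelSpace X] {μ : Measure X}
    [IsProbabilityMeasure μ] {T : X ≃ᵐ X} (hwm : IsWeaklyMixing μ T) {p : ℕ}
    (h : HasUniformFibres μ (μ.prod μ) p) : ∃ a, ∀ᵐ x ∂μ, x = a := by
  obtain ⟨hp, κ, hκ, hprod, hy⟩ := h
  have hκμ : κ =ᵐ[μ] Kernel.const X μ :=
    Kernel.ae_eq_of_compProd_eq (by rw [← hprod, Measure.compProd_const])
  obtain ⟨x, ⟨y, -, hxy⟩, hx⟩ := (hy.and hκμ).exists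
  have hμ : μ = uniformOnPoints y := by rw [← hxy, hx, Kernel.const_apply]
  have hpos : μ {y ⟨0, hp⟩} ≠ 0 := by
    intro h0
    have := inv_le_uniformOnPoints_singleton y ⟨0, hp⟩
    rw [← hμ, h0] at this
    simp at this
  have hdm : MeasurableSet (Set.diagonal X) := measurableSet_diagonal
  have hinv : Prod.map T T ⁻¹' Set.diagonal X = Set.diagonal X := by
    ext ⟨a, b⟩
    simp
  -- The square of an atom lies on the invariant diagonal, so ergodicity of `T × T` makes the
  -- diagonal full.
  have hdiag : (μ.prod μ) (Set.diagonal X) ≠ 0 := by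
    intro h0
    have hle : (μ.prod μ) ({y ⟨0, hp⟩} ×ˢ {y ⟨0, hp⟩}) ≤ (μ.prod μ) (Set.diagonal X) := by
      apply measure_mono
      rintro ⟨a, b⟩ ⟨rfl, hb⟩
      exact hb.symm
    rw [Measure.prod_prod, h0, nonpos_iff_eq_zero, mul_self_eq_zero] at hle
    exact hpos hle
  have hone := (hwm.toPreErgodic.prob_eq_zero_or_one hdm hinv).resolve_left hdiag
  have hae : ∀ᵐ z ∂(μ.prod μ), z ∈ Set.diagonal X :=
    (mem_ae_iff_prob_eq_one hdm).2 hone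
  obtain ⟨a, ha⟩ := (Measure.ae_ae_of_ae_prod hae).exists
  exact ⟨a, ha.mono fun z hz => (show a = z from hz).symm⟩

theorem eq_dirac_of_ae_eq {μ : Measure X} {a : X} (ha : ∀ᵐ x ∂μ, x = a) {n : ℕ}
    {ν : Measure (Fin n → X)} [IsProbabilityMeasure ν] (hν : ∀ i, ν.map (fun x => x i) = μ) :
    ν = Measure.dirac fun _ => a := by
  have h : ∀ᵐ x ∂ν, x = fun _ => a := by
    have : ∀ i, ∀ᵐ x ∂ν, x i = a := fun i =>
      ae_of_ae_map (measurable_pi_apply i).aemeasurable (by rw [hν i]; exact ha)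
    filter_upwards [ae_all_iff.2 this] with x hx using funext hx
  have h2 : ν.map id = ν.map fun _ => fun _ => a := Measure.map_congr h
  rwa [Measure.map_id, Measure.map_const, measure_univ, one_smul] at h2

/-- Over a point mass there is only one joining. This disposes of the degenerate case in which `μ ⊗
μ` is itself quasi-diagonal. -/
theorem IsJoining.eq_pi_of_ae_eq {μ : Measure X} [IsProbabilityMeasure μ] {T : X → X} {a : X}
    (ha : ∀ᵐ x ∂μ, x = a) {n : ℕ} {ν : Measure (Fin n → X)} (hν : IsJoining μ T ν) :
    ν = Measure.pi fun _ => μ := by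
  have := hν.isProbabilityMeasure
  rw [eq_dirac_of_ae_eq ha hν.marginal,
    eq_dirac_of_ae_eq (ν := Measure.pi fun _ : Fin n => μ) ha
      fun i => (measurePreserving_eval (fun _ => μ) i).map_eq]

/-- Finiteness of the fibres enters here: almost every point is an atom of its fibre measure, so it
avoids every fibrewise null set. -/
theorem ae_singleton_ne_zero_of_hasUniformFibres [StandardBorelSpace X] {μ : Measure X}
    [IsProbabilityMeasure μ] {κ : Kernel X X} [IsMarkovKernel κ] {p : ℕ}
    (hy : ∀ᵐ x ∂μ, ∃ y : Fin p → X, Function.Injective y ∧ κ x = uniformOnPoints y) :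
    ∀ᵐ z ∂(μ.compProd κ), κ z.1 {z.2} ≠ 0 := by
  have hm : Measurable fun z : X × X => κ z.1 {z.2} :=
    Kernel.measurable_kernel_prodMk_left (κ := κ.comap Prod.fst measurable_fst)
      (t := {q : (X × X) × X | q.2 = q.1.2}) (measurableSet_eq_fun (by fun_prop) (by fun_prop))
  refine Measure.ae_compProd_of_ae_ae (hm (measurableSet_singleton 0).compl) ?_
  filter_upwards [hy] with x ⟨y, _, hx⟩
  rw [hx]
  filter_upwards [ae_uniformOnPoints_mem_range y] with z ⟨i, hz⟩ h0
  have := inv_le_uniformOnPoints_singleton y i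
  rw [← hz, h0] at this
  simp at this

/-- A joining of `μ` with a finite extension of `μ` which is independent of the base is
absolutely continuous with respect to the product. -/
theorem absolutelyContinuous_of_hasUniformFibres [StandardBorelSpace X] {μ : Measure X}
    [IsProbabilityMeasure μ] {η : Measure (Fin 3 → X)}
    (h01 : face η 0 1 = μ.prod μ) {p : ℕ} (h12 : HasUniformFibres μ (face η 1 2) p) :
    η.map (fun x => (x 0, (x 1, x 2))) ≪ μ.prod (face η 1 2) := by
  obtain ⟨hp, κ, hκ, hprod, hy⟩ := h12
  refine Measure.AbsolutelyContinuous.mk fun N hN hN0 => ?_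
  have hm : Measurable fun x : Fin 3 → X => (x 0, (x 1, x 2)) := by fun_prop
  rw [Measure.map_apply hm hN]
  have h1 : ∀ᵐ z ∂(μ.prod μ), κ z.2 {w | (z.1, z.2, w) ∈ N} = 0 := by
    have hm' : MeasurableSet {z : X × X | κ z.2 {w | (z.1, z.2, w) ∈ N} = 0} :=
      Kernel.measurable_kernel_prodMk_left (κ := κ.comap Prod.snd measurable_snd)
        (t := {q : (X × X) × X | (q.1.1, q.1.2, q.2) ∈ N})
        (hN.preimage (by fun_prop)) (measurableSet_singleton 0)
    have : SFinite (face η 1 2) := by rw [hprod]; infer_instance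
    rw [Measure.measure_prod_null hN] at hN0
    rw [Measure.ae_prod_iff_ae_ae hm']
    filter_upwards [hN0] with x hx
    have hx' : ∀ᵐ q ∂(μ.compProd κ), q ∉ Prod.mk x ⁻¹' N := by
      rw [← hprod]
      exact measure_eq_zero_iff_ae_notMem.1 hx
    filter_upwards [Measure.ae_ae_of_ae_compProd hx'] with y hy
    exact measure_eq_zero_iff_ae_notMem.2 hy
  -- The condition involves only the coordinates 0 and 1, which are independent under `η`, so it
  -- transfers from `μ ⊗ μ`.
  have h2 : ∀ᵐ x ∂η, κ (x 1) {w | (x 0, x 1, w) ∈ N} = 0 :=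
    ae_of_ae_map (measurable_face 0 1).aemeasurable
      (p := fun z : X × X => κ z.2 {w | (z.1, z.2, w) ∈ N} = 0) (by
        change ∀ᵐ z ∂(face η 0 1), _
        rw [h01]; exact h1)
  have h3 : ∀ᵐ x ∂η, κ (x 1) {x 2} ≠ 0 :=
    ae_of_ae_map (measurable_face 1 2).aemeasurable
      (p := fun z : X × X => κ z.1 {z.2} ≠ 0) (by
        change ∀ᵐ z ∂(face η 1 2), _
        rw [hprod]; exact ae_singleton_ne_zero_of_hasUniformFibres hy)
  rw [measure_eq_zero_iff_ae_notMem]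
  filter_upwards [h2, h3] with x hx2 hx3 hxN
  refine hx3 (measure_mono_null ?_ hx2)
  rintro w rfl
  exact hxN

theorem hasUniformFibres_one_of_map {μ : Measure X} [SFinite μ] {f : X → X} (hf : Measurable f) :
    HasUniformFibres μ (μ.map fun x => (x, f x)) 1 := by
  refine ⟨one_pos, Kernel.deterministic f hf, inferInstance, ?_, ?_⟩
  · rw [Measure.compProd_deterministic]
  · refine ae_of_all _ fun x => ⟨fun _ => f x, Function.injective_of_subsingleton _, ?_⟩
    simp [uniformOnPoints, Kernel.deterministic_apply]

/-- Since `S` preserves `μ`, swapping the coordinates turns the graph measure of `S` into that of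
its inverse; both have one-point fibres. -/
theorem IsShiftedDiagonal.isQuasiDiagonal {μ : Measure X} [SFinite μ] {T : X → X}
    {ν : Measure (X × X)} (h : IsShiftedDiagonal μ T ν) : IsQuasiDiagonal μ ν := by
  obtain ⟨S, hS, -, rfl⟩ := h
  refine ⟨1, 1, hasUniformFibres_one_of_map S.measurable, ?_⟩
  have hS' : (μ.map fun x => (x, S x)).map Prod.swap = μ.map fun x => (x, S.symm x) := by
    rw [Measure.map_map measurable_swap (by fun_prop)]
    conv_rhs => rw [← hS.map_eq, Measure.map_map (by fun_prop) S.measurable]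
    congr 1
    ext x <;> simp
  rw [hS']
  exact hasUniformFibres_one_of_map S.symm.measurable

end Fibres

/-! ### Products with weakly mixing systems -/

section Product

variable {X Y : Type*} [MeasurableSpace X] [MeasurableSpace Y]

/-- Fubini in two orders for one subset of `Y × (X × X)`. -/
theorem lintegral_section_mul_section {μ : Measure X} [IsProbabilityMeasure μ] {ρ : Measure Y}
    [IsProbabilityMeasure ρ] {D : Set (X × Y)} (hD : MeasurableSet D) {A A' : Set X}
    (hA : MeasurableSet A) (hA' : MeasurableSet A') :
    ∫⁻ y, μ (A ∩ {x | (x, y) ∈ D}) * μ (A' ∩ {x | (x, y) ∈ D}) ∂ρ =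
      ∫⁻ z in A ×ˢ A', ρ {y | (z.1, y) ∈ D ∧ (z.2, y) ∈ D} ∂(μ.prod μ) := by
  set E : Set (Y × (X × X)) :=
    {q | (q.2.1 ∈ A ∧ (q.2.1, q.1) ∈ D) ∧ (q.2.2 ∈ A' ∧ (q.2.2, q.1) ∈ D)} with hEdef
  have hE : MeasurableSet E := by
    refine MeasurableSet.inter (MeasurableSet.inter ?_ ?_) (MeasurableSet.inter ?_ ?_)
    · exact hA.preimage (f := fun q : Y × (X × X) => q.2.1) (by fun_prop)
    · exact hD.preimage (f := fun q : Y × (X × X) => (q.2.1, q.1)) (by fun_prop)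
    · exact hA'.preimage (f := fun q : Y × (X × X) => q.2.2) (by fun_prop)
    · exact hD.preimage (f := fun q : Y × (X × X) => (q.2.2, q.1)) (by fun_prop)
  have h1 : (ρ.prod (μ.prod μ)) E =
      ∫⁻ y, μ (A ∩ {x | (x, y) ∈ D}) * μ (A' ∩ {x | (x, y) ∈ D}) ∂ρ := by
    rw [Measure.prod_apply hE]
    refine lintegral_congr fun y => ?_
    rw [← Measure.prod_prod]
    rfl
  have h2 : (ρ.prod (μ.prod μ)) E =
      ∫⁻ z in A ×ˢ A', ρ {y | (z.1, y) ∈ D ∧ (z.2, y) ∈ D} ∂(μ.prod μ) := by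
    rw [Measure.prod_apply_symm hE, ← lintegral_indicator (hA.prod hA')]
    refine lintegral_congr fun z => ?_
    by_cases hz : z ∈ A ×ˢ A'
    · rw [Set.indicator_of_mem hz]
      congr 1
      ext y
      have h1 := hz.1
      have h2 := hz.2
      simp [hEdef, h1, h2]
    · rw [Set.indicator_of_notMem hz]
      convert measure_empty (μ := ρ)
      ext y
      simp only [Set.mem_prod, not_and_or] at hz
      simp only [hEdef, Set.mem_preimage, Set.mem_ofPred_eq, Set.mem_empty_iff_false, iff_false]
      tauto
  rw [← h1, h2]

/-- Expanding the square, the integral of `(u - α h)²` is `cα² - 2cα² + cα² = 0`. -/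
theorem ae_eq_mul_of_integral_sq {ρ : Measure Y} [IsProbabilityMeasure ρ] {u h : Y → ℝ}
    {c α : ℝ} (hum : Measurable u) (hhm : Measurable h) (hu : ∀ y, |u y| ≤ 1)
    (hh : ∀ y, |h y| ≤ 1) (huu : ∫ y, u y * u y ∂ρ = c * (α * α))
    (huh : ∫ y, u y * h y ∂ρ = c * α) (hhh : ∫ y, h y * h y ∂ρ = c) :
    ∀ᵐ y ∂ρ, u y = α * h y := by
  have hint : ∀ {f g : Y → ℝ}, Measurable f → Measurable g → (∀ y, |f y| ≤ 1) →
      (∀ y, |g y| ≤ 1) → Integrable (fun y => f y * g y) ρ := by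
    intro f g hf hg hf1 hg1
    refine Integrable.of_bound (C := 1) (hf.mul hg).aestronglyMeasurable (ae_of_all _ fun y => ?_)
    rw [Real.norm_eq_abs, abs_mul]
    exact mul_le_one₀ (hf1 y) (abs_nonneg _) (hg1 y)
  have huu' := hint hum hum hu hu
  have huh' := hint hum hhm hu hh
  have hhh' := hint hhm hhm hh hh
  have hsq : ∀ y, (u y - α * h y) ^ 2 =
      u y * u y - 2 * α * (u y * h y) + α * α * (h y * h y) := fun y => by ring
  have huh2 : Integrable (fun y => 2 * α * (u y * h y)) ρ := huh'.const_mul _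
  have hhh2 : Integrable (fun y => α * α * (h y * h y)) ρ := hhh'.const_mul _
  have hsub : Integrable (fun y => u y * u y - 2 * α * (u y * h y)) ρ := huu'.sub huh2
  have hzero : ∫ y, (u y - α * h y) ^ 2 ∂ρ = 0 := by
    simp_rw [hsq]
    rw [integral_add hsub hhh2, integral_sub huu' huh2, integral_const_mul, integral_const_mul,
      huu, huh, hhh]
    ring
  have hi : Integrable (fun y => (u y - α * h y) ^ 2) ρ := by
    simp_rw [hsq]
    exact hsub.add hhh2
  rw [integral_eq_zero_iff_of_nonneg (fun y => sq_nonneg _) hi] at hzero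
  filter_upwards [hzero] with y hy
  have : u y - α * h y = 0 := by simpa using hy
  linarith

/-- The product of a weakly mixing system and an ergodic system is ergodic. -/
theorem ergodic_prodMap {μ : Measure X} [IsProbabilityMeasure μ] {ρ : Measure Y}
    [IsProbabilityMeasure ρ] {T : X → X} {S : Y → Y} (hT : MeasurePreserving T μ μ)
    (hwm : IsWeaklyMixing μ T) (hS : Ergodic S ρ) : Ergodic (Prod.map T S) (μ.prod ρ) := by
  refine ⟨hT.prod hS.toMeasurePreserving, ⟨fun D hD hinv => ?_⟩⟩
  have hmem : ∀ x y, (T x, S y) ∈ D ↔ (x, y) ∈ D := fun x y => by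
    conv_rhs => rw [← hinv]
    rfl
  have hsec : ∀ x, MeasurableSet {y | (x, y) ∈ D} := fun x => measurable_prodMk_left hD
  have hsec' : ∀ y, MeasurableSet {x | (x, y) ∈ D} := fun y => measurable_prodMk_right hD
  -- the correlation kernel is constant
  obtain ⟨c, hc⟩ : ∃ c, (fun z : X × X => ρ {y | (z.1, y) ∈ D ∧ (z.2, y) ∈ D})
      =ᵐ[μ.prod μ] Function.const _ c := by
    refine hwm.toPreErgodic.ae_eq_const_of_ae_eq_comp ?_ ?_
    · refine measurable_measure_prodMk_left
        (s := {q : (X × X) × Y | (q.1.1, q.2) ∈ D ∧ (q.1.2, q.2) ∈ D}) (MeasurableSet.inter ?_ ?_)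
      · exact hD.preimage (f := fun q : (X × X) × Y => (q.1.1, q.2)) (by fun_prop)
      · exact hD.preimage (f := fun q : (X × X) × Y => (q.1.2, q.2)) (by fun_prop)
    · funext z
      have := hS.measure_preimage ((hsec (T z.1)).inter (hsec (T z.2))).nullMeasurableSet
      simp only [Function.comp_apply, Prod.map_fst, Prod.map_snd]
      refine this.symm.trans ?_
      congr 1
      ext y
      simp [hmem]
  have humeas : ∀ A, MeasurableSet A → Measurable fun y => μ.real (A ∩ {x | (x, y) ∈ D}) :=
    fun A hA => (measurable_measure_prodMk_right (μ := μ)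
      ((hA.preimage measurable_fst).inter hD)).ennreal_toReal
  have hmul : ∀ A A' : Set X, MeasurableSet A → MeasurableSet A' →
      ∫ y, μ.real (A ∩ {x | (x, y) ∈ D}) * μ.real (A' ∩ {x | (x, y) ∈ D}) ∂ρ =
        c.toReal * (μ.real A * μ.real A') := by
    intro A A' hA hA'
    have := lintegral_section_mul_section (μ := μ) (ρ := ρ) hD hA hA'
    rw [setLIntegral_congr_fun_ae (hA.prod hA') (g := fun _ => c) (hc.mono fun z hz _ => hz),
      setLIntegral_const, Measure.prod_prod] at this
    have hnonneg : ∀ y, 0 ≤ μ.real (A ∩ {x | (x, y) ∈ D}) * μ.real (A' ∩ {x | (x, y) ∈ D}) :=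
      fun y => mul_nonneg measureReal_nonneg measureReal_nonneg
    have hm : Measurable fun y =>
        μ.real (A ∩ {x | (x, y) ∈ D}) * μ.real (A' ∩ {x | (x, y) ∈ D}) :=
      (humeas A hA).mul (humeas A' hA')
    rw [integral_eq_lintegral_of_nonneg_ae (ae_of_all _ hnonneg) hm.aestronglyMeasurable]
    simp_rw [measureReal_def, ← ENNReal.toReal_mul]
    rw [← this]
    congr 1
    refine lintegral_congr fun y => ?_
    rw [ENNReal.ofReal_toReal (by finiteness)]
  have hle : ∀ A y, |μ.real (A ∩ {x | (x, y) ∈ D})| ≤ 1 := fun A y => by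
    rw [abs_of_nonneg measureReal_nonneg]
    exact measureReal_le_one
  -- Constant correlations make almost every horizontal section of `D` independent of `A`.
  have hu : ∀ A, MeasurableSet A → ∀ᵐ y ∂ρ,
      μ.real (A ∩ {x | (x, y) ∈ D}) = μ.real A * μ.real (Set.univ ∩ {x | (x, y) ∈ D}) := by
    intro A hA
    refine ae_eq_mul_of_integral_sq (humeas A hA) (humeas _ .univ) (hle _) (hle _)
      (hmul A A hA hA) ?_ ?_
    · simpa using hmul A Set.univ hA .univ
    · simpa using hmul Set.univ Set.univ .univ .univ
  -- the fibre measure is invariant, hence constant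
  obtain ⟨d, hd⟩ : ∃ d, (fun y => μ {x | (x, y) ∈ D}) =ᵐ[ρ] Function.const _ d := by
    refine hS.toPreErgodic.ae_eq_const_of_ae_eq_comp (measurable_measure_prodMk_right hD) ?_
    funext y
    refine (hT.measure_preimage (hsec' (S y)).nullMeasurableSet).symm.trans ?_
    congr 1
    ext x
    simp [hmem]
  have hd1 : d ≠ ∞ := by
    obtain ⟨y, hy⟩ := hd.exists
    exact fun h => measure_ne_top μ _ (hy.trans h)
  -- So `D` is independent of every rectangle, hence of itself, which leaves `d = 0` or `d = 1`.
  have hrect : (μ.prod ρ).restrict D = d • μ.prod ρ := by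
    refine Measure.ext_prod fun {A B} hA hB => ?_
    rw [Measure.restrict_apply (hA.prod hB), Measure.smul_apply, Measure.prod_prod,
      Measure.prod_apply_symm ((hA.prod hB).inter hD)]
    have hpt : ∀ᵐ y ∂ρ, μ ((fun x => (x, y)) ⁻¹' (A ×ˢ B ∩ D)) =
        B.indicator (fun _ => d * μ A) y := by
      filter_upwards [hu A hA, hd] with y hy hy'
      by_cases hyB : y ∈ B
      · rw [Set.indicator_of_mem hyB]
        have : (fun x => (x, y)) ⁻¹' (A ×ˢ B ∩ D) = A ∩ {x | (x, y) ∈ D} := by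
          ext x
          simp [hyB]
        rw [this, ← ENNReal.toReal_eq_toReal_iff' (by finiteness) (by finiteness)]
        rw [Set.univ_inter] at hy
        have hy'' : μ {x | (x, y) ∈ D} = d := hy'
        rw [measureReal_def, measureReal_def, measureReal_def, hy''] at hy
        rw [hy, ENNReal.toReal_mul, mul_comm]
      · rw [Set.indicator_of_notMem hyB]
        convert measure_empty (μ := μ)
        ext x
        simp [hyB]
    rw [lintegral_congr_ae hpt, lintegral_indicator hB, setLIntegral_const, smul_eq_mul, mul_assoc]
  have h1 : (μ.prod ρ) D = d := by
    have := congrArg (fun m => m Set.univ) hrect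
    simpa using this
  have h2 : (μ.prod ρ) D = d * (μ.prod ρ) D := by
    have := congrArg (fun m => m D) hrect
    simpa using this
  rw [Filter.eventuallyConst_set']
  rcases eq_or_ne d 0 with h0 | h0
  · left
    exact ae_eq_empty.2 (h1.trans h0)
  · right
    rw [h1] at h2
    have hd' : d = 1 := by
      have := (ENNReal.mul_eq_left (a := d) (b := d) h0 hd1).1 h2.symm
      exact this
    exact Filter.eventuallyEq_univ.2 ((mem_ae_iff_prob_eq_one hD).2 (h1.trans hd'))

end Product

/-! ### Ergodic decomposition -/

section Decomposition

open Filter Topology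

theorem abs_birkhoffAverage_indicator_le {Ω : Type*} (S : Ω → Ω) (B : Set Ω) (n : ℕ) (x : Ω) :
    ‖birkhoffAverage ℝ S (B.indicator fun _ => (1 : ℝ)) n x‖ ≤ 1 := by
  simp only [birkhoffAverage, birkhoffSum, smul_eq_mul]
  rw [norm_mul, norm_inv, Real.norm_natCast]
  have : ‖∑ k ∈ Finset.range n, B.indicator (fun _ => (1 : ℝ)) (S^[k] x)‖ ≤ n := by
    refine (norm_sum_le_of_le (Finset.range n) (f := fun k =>
      B.indicator (fun _ => (1 : ℝ)) (S^[k] x)) (n := fun _ => 1) fun k _ => ?_).trans (by simp)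
    exact (norm_indicator_le_norm_self _ _).trans (by simp)
  rcases Nat.eq_zero_or_pos n with rfl | hn
  · simp
  · rw [inv_mul_le_iff₀ (by positivity)]
    simpa using this

section CondExpKernel

variable {Ω : Type*} {m mΩ : MeasurableSpace Ω}

/-- The trimmed measure and the kernel compose to the image of `η` under the diagonal map; this is
its value on a rectangle. -/
theorem setLIntegral_condExpKernel_trim [StandardBorelSpace Ω] {η : Measure Ω}
    [IsFiniteMeasure η] (hm : m ≤ mΩ) {Q B : Set Ω}
    (hQ : MeasurableSet[m] Q) (hB : MeasurableSet B) :
    ∫⁻ ω in Q, condExpKernel η m ω B ∂(η.trim hm) = η (Q ∩ B) := by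
  have h := congrArg (fun ρ => ρ (Q ×ˢ B)) (compProd_trim_condExpKernel (μ := η) hm)
  rw [Measure.compProd_apply_prod hQ hB] at h
  have hd : @Measurable _ _ mΩ (m.prod mΩ) (Function.diag : Ω → Ω × Ω) :=
    (measurable_id'' hm).prodMk measurable_id
  rw [h, @Measure.map_apply _ _ mΩ (m.prod mΩ) _ _ hd _ (MeasurableSet.prod hQ hB)]
  rfl

/-- The joint law of `ω` and a point drawn from its conditional measure is carried by the diagonal,
where the two values of `g` agree. -/
theorem ae_ae_condExpKernel_eq [StandardBorelSpace Ω] {η : Measure Ω}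
    [IsFiniteMeasure η] (hm : m ≤ mΩ) {g : Ω → ℝ} (hg : Measurable[m] g) :
    ∀ᵐ ω ∂η, ∀ᵐ x ∂(condExpKernel η m ω), g x = g ω := by
  refine ae_of_ae_trim hm
    (Measure.ae_ae_of_ae_compProd (p := fun q : Ω × Ω => g q.2 = g q.1) ?_)
  rw [compProd_trim_condExpKernel hm]
  have hms : @MeasurableSet _ (m.prod mΩ) {q : Ω × Ω | g q.2 = g q.1} :=
    @measurableSet_eq_fun _ _ (m.prod mΩ) _ _ _ _
      ((hg.mono hm le_rfl).comp (@measurable_snd _ _ m mΩ)) (hg.comp (@measurable_fst _ _ m mΩ))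
  have hd : @Measurable _ _ mΩ (m.prod mΩ) (Function.diag : Ω → Ω × Ω) :=
    (measurable_id'' hm).prodMk measurable_id
  exact (@ae_map_iff _ _ mΩ (m.prod mΩ) _ _
    (@Measurable.aemeasurable _ _ mΩ (m.prod mΩ) _ _ hd) _ hms).2 (ae_of_all _ fun x => rfl)

theorem ae_ae_condExpKernel_of_ae [StandardBorelSpace Ω] {η : Measure Ω}
    [IsFiniteMeasure η] (hm : m ≤ mΩ) {p : Ω → Prop} (hp : ∀ᵐ x ∂η, p x) :
    ∀ᵐ ω ∂η, ∀ᵐ x ∂(condExpKernel η m ω), p x := by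
  refine ae_of_ae_trim hm (Measure.ae_ae_of_ae_comp ?_)
  rwa [condExpKernel_comp_trim hm]

end CondExpKernel

variable {Ω : Type*} [mΩ : MeasurableSpace Ω]

/-- The `σ`-algebra of measurable sets that are almost everywhere invariant. -/
@[reducible] def aeInvariants (η : Measure Ω) (S : Ω → Ω) : MeasurableSpace Ω where
  MeasurableSet' s := MeasurableSet s ∧ S ⁻¹' s =ᵐ[η] s
  measurableSet_empty := ⟨MeasurableSet.empty, by simp⟩
  measurableSet_compl s hs := ⟨hs.1.compl, hs.2.compl⟩
  measurableSet_iUnion s hs := ⟨MeasurableSet.iUnion fun i => (hs i).1, by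
    rw [Set.preimage_iUnion]
    exact Filter.EventuallyEq.countable_iUnion fun i => (hs i).2⟩

theorem aeInvariants_le (η : Measure Ω) (S : Ω → Ω) : aeInvariants η S ≤ mΩ := fun _ hs => hs.1

theorem measurable_aeInvariants {η : Measure Ω} {S : Ω → Ω} {g : Ω → ℝ} (hg : Measurable g)
    (hgS : g ∘ S =ᵐ[η] g) : Measurable[aeInvariants η S] g := fun C hC =>
  ⟨hg hC, hgS.preimage C⟩

/-- Along a subsequence, the Birkhoff averages of an indicator function converge almost everywhere
to an invariant function. -/
theorem exists_tendsto_birkhoffAverage_indicator {η : Measure Ω} [IsProbabilityMeasure η]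
    {S : Ω → Ω} (hS : MeasurePreserving S η η) {B : Set Ω} (hB : MeasurableSet B) :
    ∃ g : Ω → ℝ, Measurable[aeInvariants η S] g ∧ ∃ ns : ℕ → ℕ, StrictMono ns ∧
      ∀ᵐ x ∂η, Tendsto (fun k => birkhoffAverage ℝ S (B.indicator fun _ => (1 : ℝ)) (ns k) x)
        atTop (𝓝 (g x)) := by
  set U : Lp ℝ 2 η →L[ℝ] Lp ℝ 2 η :=
    (Lp.compMeasurePreservingₗᵢ ℝ S hS).toContinuousLinearMap with hU
  set f : Lp ℝ 2 η := indicatorConstLp 2 hB (measure_ne_top η B) (1 : ℝ) with hf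
  have hUx : ∀ v : Lp ℝ 2 η, (U v : Ω → ℝ) =ᵐ[η] v ∘ S := fun v =>
    Lp.coeFn_compMeasurePreserving v hS
  -- The mean ergodic theorem for the Koopman isometry gives convergence in `L²`, hence almost
  -- everywhere along a subsequence. The pointwise ergodic theorem is not needed.
  have hmean := U.tendsto_birkhoffAverage_orthogonalProjection
    (LinearIsometry.norm_toContinuousLinearMap_le _) f
  set L := (U.eqLocus (1 : Lp ℝ 2 η →L[ℝ] Lp ℝ 2 η)).orthogonalProjectionOnto f with hL
  have hLinv : U (L : Lp ℝ 2 η) = L := L.2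
  refine ⟨(L : Lp ℝ 2 η), measurable_aeInvariants (Lp.stronglyMeasurable _).measurable ?_, ?_⟩
  · have := hUx L
    rw [hLinv] at this
    exact this.symm
  have hiter : ∀ n, ((U^[n] f : Lp ℝ 2 η) : Ω → ℝ) =ᵐ[η]
      fun x => B.indicator (fun _ => (1 : ℝ)) (S^[n] x) := by
    intro n
    induction n with
    | zero => exact indicatorConstLp_coeFn (hs := hB) (hμs := measure_ne_top η B)
    | succ n ih =>
      rw [Function.iterate_succ_apply']
      filter_upwards [hUx (U^[n] f), hS.quasiMeasurePreserving.ae ih] with x hx hx'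
      rw [hx, Function.comp_apply, hx', Function.iterate_succ_apply]
  have havg : ∀ n, ((birkhoffAverage ℝ U _root_.id n f : Lp ℝ 2 η) : Ω → ℝ) =ᵐ[η]
      birkhoffAverage ℝ S (B.indicator fun _ => (1 : ℝ)) n := by
    intro n
    filter_upwards [Lp.coeFn_smul ((n : ℝ)⁻¹) (∑ k ∈ Finset.range n, U^[k] f),
      Lp.coeFn_finsetSum (Finset.range n) (fun k => U^[k] f), ae_all_iff.2 hiter] with x h1 h2 h3
    simp only [birkhoffAverage, birkhoffSum, id]
    rw [h1, Pi.smul_apply, h2, Finset.sum_apply]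
    simp only [h3]
  obtain ⟨ns, hns, hlim⟩ := (tendstoInMeasure_of_tendsto_Lp hmean).exists_seq_tendsto_ae
  refine ⟨ns, hns, ?_⟩
  filter_upwards [hlim, ae_all_iff.2 havg] with x hx hx'
  simpa only [hx'] using hx

/-- The conditional measures are almost everywhere invariant. -/
theorem ae_measurePreserving_condExpKernel [StandardBorelSpace Ω] {η : Measure Ω}
    [IsProbabilityMeasure η] {S : Ω → Ω} (hS : MeasurePreserving S η η)
    {𝒜 : Set (Set Ω)} (h𝒜c : 𝒜.Countable) (h𝒜 : mΩ = MeasurableSpace.generateFrom 𝒜)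
    (h𝒜π : IsPiSystem 𝒜) :
    ∀ᵐ ω ∂η, MeasurePreserving S (condExpKernel η (aeInvariants η S) ω)
      (condExpKernel η (aeInvariants η S) ω) := by
  have hm := aeInvariants_le η S
  have hmeas : ∀ B ∈ 𝒜, MeasurableSet B := fun B hB => by
    rw [h𝒜]; exact MeasurableSpace.measurableSet_generateFrom hB
  have key : ∀ B ∈ 𝒜, ∀ᵐ ω ∂η, condExpKernel η (aeInvariants η S) ω (S ⁻¹' B) = condExpKernel η (aeInvariants η S) ω B := by
    intro B hB
    have hB' := hmeas B hB
    refine ae_of_ae_trim hm ?_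
    refine ae_eq_of_forall_setLIntegral_eq_of_sigmaFinite
      (measurable_condExpKernel (hS.measurable hB')) (measurable_condExpKernel hB') ?_
    intro Q hQ _
    rw [setLIntegral_condExpKernel_trim hm hQ (hS.measurable hB'),
      setLIntegral_condExpKernel_trim hm hQ hB',
      ← hS.measure_preimage (hQ.1.inter hB').nullMeasurableSet, Set.preimage_inter]
    -- `Q` is invariant only up to a null set, which suffices here.
    exact measure_congr (hQ.2.symm.inter (ae_eq_refl _))
  filter_upwards [(ae_ball_iff h𝒜c).2 key] with ω hω
  refine ⟨hS.measurable, ?_⟩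
  have := Measure.isProbabilityMeasure_map (μ := condExpKernel η (aeInvariants η S) ω) hS.measurable.aemeasurable
  refine ext_of_generate_finite 𝒜 h𝒜 h𝒜π (fun B hB => ?_) (by simp)
  rw [Measure.map_apply hS.measurable (hmeas B hB), hω B hB]

/-- `S` preserves the restriction of `κ` to the invariant set `D`, so all terms of the average have
the same integral. The empty average `n = 0` would be zero. -/
theorem setIntegral_birkhoffAverage_indicator {κ : Measure Ω} [IsProbabilityMeasure κ]
    {S : Ω → Ω} (hS : MeasurePreserving S κ κ) {B D : Set Ω} (hB : MeasurableSet B)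
    (hD : MeasurableSet D) (hDinv : S ⁻¹' D = D) {n : ℕ} (hn : n ≠ 0) :
    ∫ x in D, birkhoffAverage ℝ S (B.indicator fun _ => (1 : ℝ)) n x ∂κ = κ.real (D ∩ B) := by
  have hSD : MeasurePreserving S (κ.restrict D) (κ.restrict D) := by
    simpa only [hDinv] using hS.restrict_preimage hD
  have hi : Integrable (B.indicator fun _ => (1 : ℝ)) (κ.restrict D) :=
    (integrable_const 1).indicator hB
  have hint : ∀ k, Integrable (fun x => B.indicator (fun _ => (1 : ℝ)) (S^[k] x))
      (κ.restrict D) := fun k => (hSD.iterate k).integrable_comp_of_integrable hi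
  have hval : ∀ k, ∫ x in D, B.indicator (fun _ => (1 : ℝ)) (S^[k] x) ∂κ = κ.real (D ∩ B) := by
    intro k
    have h1 := integral_map (hSD.iterate k).measurable.aemeasurable
      (f := B.indicator fun _ => (1 : ℝ)) (by
        rw [(hSD.iterate k).map_eq]; exact hi.aestronglyMeasurable)
    rw [(hSD.iterate k).map_eq] at h1
    rw [← h1, integral_indicator hB, setIntegral_const, smul_eq_mul, mul_one, measureReal_def,
      measureReal_def, Measure.restrict_apply hB, Set.inter_comm]
  simp only [birkhoffAverage, birkhoffSum, smul_eq_mul]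
  rw [integral_const_mul, integral_finsetSum _ fun k _ => hint k]
  simp only [hval, Finset.sum_const, Finset.card_range, nsmul_eq_mul]
  field_simp

/-- If the averages of the sets of a generating `π`-system converge to constants, the system is
ergodic. -/
theorem ergodic_of_tendsto_birkhoffAverage {κ : Measure Ω} [IsProbabilityMeasure κ]
    {S : Ω → Ω} (hS : MeasurePreserving S κ κ) {𝒜 : Set (Set Ω)}
    (h𝒜 : mΩ = MeasurableSpace.generateFrom 𝒜) (h𝒜π : IsPiSystem 𝒜)
    (h : ∀ B ∈ 𝒜, ∃ (c : ℝ) (ns : ℕ → ℕ), StrictMono ns ∧ ∀ᵐ x ∂κ, Tendsto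
      (fun k => birkhoffAverage ℝ S (B.indicator fun _ => (1 : ℝ)) (ns k) x) atTop (𝓝 c)) :
    Ergodic S κ := by
  refine ⟨hS, ⟨fun D hD hDinv => ?_⟩⟩
  have hmeas : ∀ B ∈ 𝒜, MeasurableSet B := fun B hB => by
    rw [h𝒜]; exact MeasurableSpace.measurableSet_generateFrom hB
  have hmul : ∀ B ∈ 𝒜, κ.real (D ∩ B) = κ.real D * κ.real B := by
    intro B hB
    obtain ⟨c, ns, hns, hlim⟩ := h B hB
    have hms : Measurable (B.indicator fun _ => (1 : ℝ)) :=
      measurable_const.indicator (hmeas B hB)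
    -- Integrate the averages over `E` and pass to the limit. The case `E = univ` identifies `c`,
    -- the case `E = D` gives independence of `D` and `B`.
    have hlimD : ∀ E, MeasurableSet E → S ⁻¹' E = E → κ.real (E ∩ B) = κ.real E * c := by
      intro E hE hEinv
      have h1 := tendsto_integral_of_dominated_convergence (μ := κ.restrict E)
        (F := fun k => birkhoffAverage ℝ S (B.indicator fun _ => (1 : ℝ)) (ns k))
        (f := fun _ => c) (fun _ => 1) ?_ (integrable_const 1) ?_ (ae_restrict_of_ae hlim)
      · have h2 : Tendsto (fun k => ∫ x in E, birkhoffAverage ℝ S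
            (B.indicator fun _ => (1 : ℝ)) (ns k) x ∂κ) atTop (𝓝 (κ.real (E ∩ B))) := by
          refine tendsto_const_nhds.congr' ?_
          filter_upwards [eventually_ge_atTop 1] with k hk
          refine (setIntegral_birkhoffAverage_indicator hS (hmeas B hB) hE hEinv ?_).symm
          have := hns.id_le k
          simp only [id] at this
          omega
        rw [tendsto_nhds_unique h2 h1, setIntegral_const, smul_eq_mul]
      · intro k
        refine Measurable.aestronglyMeasurable ?_
        have hsum : Measurable fun x => ∑ i ∈ Finset.range (ns k),
            B.indicator (fun _ => (1 : ℝ)) (S^[i] x) :=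
          Finset.measurable_sum _ fun i _ => hms.comp (hS.measurable.iterate i)
        exact hsum.const_smul ((ns k : ℝ)⁻¹)
      · exact fun k => ae_of_all _ fun x => abs_birkhoffAverage_indicator_le S B _ x
    have hc : κ.real B = c := by simpa using hlimD Set.univ .univ rfl
    rw [hlimD D hD hDinv, hc]
  have hres : κ.restrict D = κ D • κ := by
    refine ext_of_generate_finite 𝒜 h𝒜 h𝒜π (fun B hB => ?_) (by simp)
    rw [Measure.restrict_apply (hmeas B hB), Measure.smul_apply, smul_eq_mul, Set.inter_comm,
      ← ENNReal.toReal_eq_toReal_iff' (by finiteness) (by finiteness), ENNReal.toReal_mul]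
    exact hmul B hB
  have h2 : κ D = κ D * κ D := by
    have := congrArg (fun m => m D) hres
    simpa using this
  rw [eventuallyConst_set']
  rcases eq_or_ne (κ D) 0 with h0 | h0
  · exact Or.inl (ae_eq_empty.2 h0)
  · exact Or.inr (eventuallyEq_univ.2 ((mem_ae_iff_prob_eq_one hD).2
      ((ENNReal.mul_eq_left h0 (measure_ne_top _ _)).1 h2.symm)))

/-- **Ergodic decomposition** of an invariant probability measure. -/
theorem exists_ergodic_decomposition [StandardBorelSpace Ω] {η : Measure Ω}
    [IsProbabilityMeasure η] {S : Ω → Ω} (hS : MeasurePreserving S η η) :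
    ∃ κ : Kernel Ω Ω, IsMarkovKernel κ ∧ η.bind κ = η ∧ ∀ᵐ ω ∂η, Ergodic S (κ ω) := by
  have hm := aeInvariants_le η S
  -- A countable algebra: one null set of `ω` serves all its members, and it is a `π`-system.
  set 𝒜 := generateSetAlgebra (MeasurableSpace.countableGeneratingSet Ω)
  have h𝒜c : 𝒜.Countable :=
    countable_generateSetAlgebra (MeasurableSpace.countable_countableGeneratingSet)
  have h𝒜 : mΩ = MeasurableSpace.generateFrom 𝒜 := by
    rw [generateFrom_generateSetAlgebra_eq,
      MeasurableSpace.generateFrom_countableGeneratingSet]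
  have h𝒜π : IsPiSystem 𝒜 := fun s hs t ht _ => isSetAlgebra_generateSetAlgebra.inter_mem hs ht
  refine ⟨(condExpKernel η (aeInvariants η S)).comap id (measurable_id'' hm), inferInstance, ?_, ?_⟩
  · ext B hB
    rw [Measure.bind_apply hB (Kernel.aemeasurable _)]
    have := setLIntegral_condExpKernel_trim (η := η) hm (Q := Set.univ) MeasurableSet.univ hB
    rw [Measure.restrict_univ, lintegral_trim hm (measurable_condExpKernel hB),
      Set.univ_inter] at this
    exact this
  · have hlim : ∀ B ∈ 𝒜, ∀ᵐ ω ∂η, ∃ (c : ℝ) (ns : ℕ → ℕ), StrictMono ns ∧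
        ∀ᵐ x ∂(condExpKernel η (aeInvariants η S) ω), Tendsto
        (fun k => birkhoffAverage ℝ S (B.indicator fun _ => (1 : ℝ)) (ns k) x) atTop (𝓝 c) := by
      intro B hB
      have hB' : MeasurableSet B := by
        rw [h𝒜]; exact MeasurableSpace.measurableSet_generateFrom hB
      obtain ⟨g, hg, ns, hns, hgl⟩ := exists_tendsto_birkhoffAverage_indicator hS hB'
      filter_upwards [ae_ae_condExpKernel_of_ae hm hgl, ae_ae_condExpKernel_eq hm hg] with ω hω1 hω2
      refine ⟨g ω, ns, hns, ?_⟩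
      filter_upwards [hω1, hω2] with x hx1 hx2
      rwa [hx2] at hx1
    filter_upwards [(ae_ball_iff h𝒜c).2 hlim,
      ae_measurePreserving_condExpKernel hS h𝒜c h𝒜 h𝒜π] with ω hω hωS
    exact ergodic_of_tendsto_birkhoffAverage hωS h𝒜 h𝒜π hω

end Decomposition

/-! ### Equivariant correlations of Hilbert space valued functions -/

section Hilbert

open Filter

/-- The union `G` of the iterated preimages of `Q` contains its own preimage, so it is null or full;
it contains `Q`, so it is full and meets `P`. -/
theorem _root_.Ergodic.exists_measure_inter_preimage_iterate_ne_zero {Z : Type*}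
    [MeasurableSpace Z] {m : Measure Z} [IsFiniteMeasure m] {R : Z → Z} (hR : Ergodic R m)
    {P Q : Set Z} (hP : m P ≠ 0) (hQ : MeasurableSet Q) (hQ0 : m Q ≠ 0) :
    ∃ n : ℕ, m (P ∩ R^[n] ⁻¹' Q) ≠ 0 := by
  by_contra! hcon
  set G := ⋃ n : ℕ, R^[n] ⁻¹' Q with hG
  have hGm : MeasurableSet G := MeasurableSet.iUnion fun n => hR.measurable.iterate n hQ
  have hRG : R ⁻¹' G ⊆ G := by
    intro z hz
    obtain ⟨n, hn⟩ := Set.mem_iUnion.1 hz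
    refine Set.mem_iUnion.2 ⟨n + 1, ?_⟩
    rwa [Set.mem_preimage, Function.iterate_succ_apply]
  have hQG : Q ⊆ G := Set.subset_iUnion (fun n : ℕ => R^[n] ⁻¹' Q) 0
  rcases hR.ae_empty_or_univ_of_preimage_ae_le hGm.nullMeasurableSet
    (LE.le.eventuallyLE hRG) with h | h
  · exact hQ0 (measure_mono_null hQG (ae_eq_empty.1 h))
  · have h1 : m (P ∩ G) = 0 := by
      rw [hG, Set.inter_iUnion]
      exact measure_iUnion_null hcon
    refine hP ?_
    rw [← h1]
    refine measure_congr ?_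
    simpa using (ae_eq_refl P).inter h.symm

open scoped RealInnerProductSpace

variable {X : Type*} [MeasurableSpace X] {H : Type*} [NormedAddCommGroup H]
  [InnerProductSpace ℝ H]

/-- The vectors `u` and `v` of norm `r` are within `2ε = r/2` of each other, so `d ≥ 7r²/8`. Since
`a` is near `h` and `b` makes a nonpositive product with `h`, also `d ≤ εr = r²/4`. -/
theorem inner_le_of_norm_sub_lt {a b u v h : H} {d ε r : ℝ} (hr : 0 < r) (hε : ε = r / 4)
    (hu : ‖u‖ = r) (hv : ‖v‖ = r) (hb : ‖b‖ = r) (huv : ⟪u, v⟫ = d) (hab : ⟪a, b⟫ = d)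
    (hu' : ‖u - h‖ < ε) (hv' : ‖v - h‖ < ε) (ha' : ‖a - h‖ < ε) (hbh : ⟪b, h⟫ ≤ 0) : False := by
  have h1 : ‖u - v‖ ≤ 2 * ε := by
    calc ‖u - v‖ = ‖(u - h) - (v - h)‖ := by congr 1; abel
      _ ≤ ‖u - h‖ + ‖v - h‖ := norm_sub_le _ _
      _ ≤ 2 * ε := by linarith
  have h2 : ‖u - v‖ ^ 2 = r ^ 2 - 2 * d + r ^ 2 := by
    rw [norm_sub_sq_real, hu, hv, huv]
  have h3 : ‖u - v‖ ^ 2 ≤ (2 * ε) ^ 2 := by gcongr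
  have h4 : d ≤ ε * r := by
    have : d = ⟪a - h, b⟫ + ⟪b, h⟫ := by
      rw [inner_sub_left, hab, real_inner_comm b h]; ring
    have h5 : ⟪a - h, b⟫ ≤ ‖a - h‖ * ‖b‖ := real_inner_le_norm _ _
    have h6 : ‖a - h‖ * ‖b‖ ≤ ε * r := by rw [hb]; gcongr
    linarith
  subst hε
  nlinarith

/-- Let `Φ` be a function on a weakly mixing system with values in a separable Hilbert space and
with mean zero. If all the correlations `⟪Φ x, Φ (Tᵏ x)⟫` are constant, then `Φ` vanishes. -/
theorem ae_eq_zero_of_inner_iterate_const [SecondCountableTopology H] {μ : Measure X}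
    [IsProbabilityMeasure μ] {T : X → X} (hT : MeasurePreserving T μ μ)
    (hwm : IsWeaklyMixing μ T) {Φ : X → H} (hnorm : ∀ v, Measurable fun x => ‖Φ x - v‖)
    (hinner : ∀ v, Measurable fun x => ⟪Φ x, v⟫)
    (hc : ∀ k : ℕ, ∃ c, ∀ᵐ x ∂μ, ⟪Φ x, Φ (T^[k] x)⟫ = c)
    (h0 : ∀ v, ∫ x, ⟪Φ x, v⟫ ∂μ = 0) : ∀ᵐ x ∂μ, Φ x = 0 := by
  obtain ⟨r, hr0, hr⟩ : ∃ r : ℝ, 0 ≤ r ∧ ∀ᵐ x ∂μ, ‖Φ x‖ = r := by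
    obtain ⟨c, hc⟩ := hc 0
    refine ⟨√c, Real.sqrt_nonneg c, hc.mono fun x hx => ?_⟩
    rw [← hx, Function.iterate_zero, id, real_inner_self_eq_norm_sq,
      Real.sqrt_sq (norm_nonneg _)]
  rcases hr0.eq_or_lt with rfl | hrpos
  · exact hr.mono fun x hx => norm_eq_zero.1 hx
  exfalso
  obtain ⟨ε, hε⟩ : ∃ ε, ε = r / 4 := ⟨_, rfl⟩
  have hεpos : 0 < ε := by rw [hε]; positivity
  have hAmeas : ∀ v, MeasurableSet {x | ‖Φ x - v‖ < ε} := fun v =>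
    measurableSet_lt (hnorm v) measurable_const
  -- By separability, countably many balls of radius `ε` cover `H`.
  obtain ⟨h, hA⟩ : ∃ h, μ {x | ‖Φ x - h‖ < ε} ≠ 0 := by
    by_contra! hcon
    have hcov : (⋃ k : ℕ, {x | ‖Φ x - TopologicalSpace.denseSeq H k‖ < ε}) = Set.univ := by
      refine Set.eq_univ_of_forall fun x => Set.mem_iUnion.2 ?_
      obtain ⟨k, hk⟩ := (TopologicalSpace.denseRange_denseSeq H).exists_dist_lt (Φ x) hεpos
      exact ⟨k, by simpa [dist_eq_norm] using hk⟩
    have : μ Set.univ = 0 := by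
      rw [← hcov]
      exact measure_iUnion_null fun k => hcon _
    simp at this
  set A := {x | ‖Φ x - h‖ < ε} with hAdef
  set B := {x | ⟪Φ x, h⟫ ≤ 0} with hBdef
  have hBmeas : MeasurableSet B := measurableSet_le (hinner h) measurable_const
  -- Otherwise `⟪Φ x, h⟫` would be positive almost everywhere, against the mean being zero.
  have hB : μ B ≠ 0 := by
    intro hB0
    have hpos : ∀ᵐ x ∂μ, 0 < ⟪Φ x, h⟫ := by
      filter_upwards [measure_eq_zero_iff_ae_notMem.1 hB0] with x hx
      exact not_le.1 hx
    have hint : Integrable (fun x => ⟪Φ x, h⟫) μ := by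
      refine Integrable.of_bound (C := r * ‖h‖) (hinner h).aestronglyMeasurable ?_
      filter_upwards [hr] with x hx
      rw [← hx]
      exact norm_inner_le_norm _ _
    have hz := (integral_eq_zero_iff_of_nonneg_ae (hpos.mono fun x hx => hx.le) hint).1 (h0 h)
    obtain ⟨x, hx1, hx2⟩ := (hpos.and hz).exists
    exact hx1.ne' hx2
  -- Weak mixing: at one time `n`, the first of two points of `A` goes to `B` while the second
  -- returns to `A`.
  obtain ⟨n, hn⟩ := hwm.exists_measure_inter_preimage_iterate_ne_zero (P := A ×ˢ A)
    (Q := B ×ˢ A) (by rw [Measure.prod_prod]; exact mul_ne_zero hA hA) (hBmeas.prod (hAmeas h))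
    (by rw [Measure.prod_prod]; exact mul_ne_zero hB hA)
  obtain ⟨d, hd⟩ := hc n
  have hgood : ∀ᵐ x ∂μ, ‖Φ x‖ = r ∧ ‖Φ (T^[n] x)‖ = r ∧ ⟪Φ x, Φ (T^[n] x)⟫ = d := by
    filter_upwards [hr, (hT.iterate n).quasiMeasurePreserving.ae hr, hd] with x h1 h2 h3
    exact ⟨h1, h2, h3⟩
  have hgood2 : ∀ᵐ z ∂(μ.prod μ),
      (‖Φ z.1‖ = r ∧ ‖Φ (T^[n] z.1)‖ = r ∧ ⟪Φ z.1, Φ (T^[n] z.1)⟫ = d) ∧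
      (‖Φ z.2‖ = r ∧ ‖Φ (T^[n] z.2)‖ = r ∧ ⟪Φ z.2, Φ (T^[n] z.2)⟫ = d) :=
    (Measure.quasiMeasurePreserving_fst.ae hgood).and
      (Measure.quasiMeasurePreserving_snd.ae hgood)
  obtain ⟨⟨x, y⟩, ⟨hxy, hRxy⟩, hgx, hgy⟩ :=
    ((frequently_ae_mem_iff.2 hn).and_eventually hgood2).exists
  have hR : (Prod.map T T)^[n] (x, y) = (T^[n] x, T^[n] y) := by
    rw [Prod.map_iterate]; rfl
  rw [Set.mem_preimage, hR] at hRxy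
  exact inner_le_of_norm_sub_lt hrpos hε hgy.1 hgy.2.1 hgx.2.1 hgy.2.2 hgx.2.2
    hxy.2 hRxy.2 hxy.1 hRxy.1

end Hilbert

/-! ### Constant correlations of functions on a product space -/

section Correlations

open scoped RealInnerProductSpace

variable {X Y : Type*} [MeasurableSpace X] [MeasurableSpace Y]

/-- A bounded function on the product of a weakly mixing system and a probability space, with mean
zero on almost every horizontal fibre, vanishes if the correlations of its vertical fibres along
the orbits are constant. -/
theorem ae_eq_zero_of_correlation_const [MeasurableSpace.CountablyGenerated Y] {μ : Measure X}
    [IsProbabilityMeasure μ] {T : X → X} (hT : MeasurePreserving T μ μ)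
    (hwm : IsWeaklyMixing μ T) {lam : Measure Y} [IsProbabilityMeasure lam] {F : X → Y → ℝ}
    (hF : Measurable (Function.uncurry F)) (hF1 : ∀ x y, ‖F x y‖ ≤ 1)
    (hc : ∀ k : ℕ, ∃ c, ∀ᵐ x ∂μ, ∫ y, F x y * F (T^[k] x) y ∂lam = c)
    (h0 : ∀ᵐ y ∂lam, ∫ x, F x y ∂μ = 0) : ∀ᵐ x ∂μ, ∀ᵐ y ∂lam, F x y = 0 := by
  have hFx : ∀ x, Measurable (F x) := fun x => hF.comp measurable_prodMk_left
  have hmem : ∀ x, MemLp (F x) 2 lam := fun x =>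
    MemLp.of_bound (hFx x).aestronglyMeasurable 1 (ae_of_all _ (hF1 x))
  set Φ : X → Lp ℝ 2 lam := fun x => (hmem x).toLp (F x) with hΦ
  have hΦae : ∀ x, (Φ x : Y → ℝ) =ᵐ[lam] F x := fun x => (hmem x).coeFn_toLp
  have hin : ∀ x (v : Lp ℝ 2 lam), ⟪Φ x, v⟫ = ∫ y, F x y * v y ∂lam := by
    intro x v
    rw [L2.inner_def]
    refine integral_congr_ae ?_
    filter_upwards [hΦae x] with y hy
    rw [hy, real_inner_comm]; rfl
  have hin2 : ∀ x x', ⟪Φ x, Φ x'⟫ = ∫ y, F x y * F x' y ∂lam := by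
    intro x x'
    rw [hin]
    refine integral_congr_ae ?_
    filter_upwards [hΦae x'] with y hy
    rw [hy]
  have hmeas : ∀ v : Lp ℝ 2 lam, Measurable (Function.uncurry fun x y => F x y * v y) :=
    fun v => hF.mul ((Lp.stronglyMeasurable v).measurable.comp measurable_snd)
  have hinner : ∀ v : Lp ℝ 2 lam, Measurable fun x => ⟪Φ x, v⟫ := by
    intro v
    simp_rw [hin]
    exact ((hmeas v).stronglyMeasurable.integral_prod_right).measurable
  have hsq : Measurable fun x => ⟪Φ x, Φ x⟫ := by
    simp_rw [hin2]
    exact ((hF.mul hF).stronglyMeasurable.integral_prod_right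
      (f := fun x y => F x y * F x y)).measurable
  -- Expanding the norm reduces its measurability to that of scalar products, which are integrals
  -- with a parameter.
  have hnorm : ∀ v : Lp ℝ 2 lam, Measurable fun x => ‖Φ x - v‖ := by
    intro v
    have : ∀ x, ‖Φ x - v‖ = √(⟪Φ x, Φ x⟫ - 2 * ⟪Φ x, v⟫ + ‖v‖ ^ 2) := by
      intro x
      rw [real_inner_self_eq_norm_sq, ← norm_sub_sq_real, Real.sqrt_sq (norm_nonneg _)]
    simp_rw [this]
    exact ((hsq.sub ((hinner v).const_mul 2)).add_const _).sqrt
  have hzero : ∀ v : Lp ℝ 2 lam, ∫ x, ⟪Φ x, v⟫ ∂μ = 0 := by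
    intro v
    simp_rw [hin]
    have hv : Integrable v lam := (Lp.memLp v).integrable (by norm_num)
    have hint : Integrable (Function.uncurry fun x y => F x y * v y) (μ.prod lam) := by
      refine Integrable.mono (hv.comp_snd μ) (hmeas v).aestronglyMeasurable
        (ae_of_all _ fun q => ?_)
      simp only [Function.uncurry, norm_mul]
      exact mul_le_of_le_one_left (norm_nonneg _) (hF1 _ _)
    rw [integral_integral_swap hint]
    have : ∀ᵐ y ∂lam, ∫ x, F x y * v y ∂μ = 0 := by
      filter_upwards [h0] with y hy
      rw [integral_mul_const, hy, zero_mul]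
    rw [integral_congr_ae this, integral_zero]
  have : Fact ((2 : ℝ≥0∞) ≠ ∞) := ⟨by norm_num⟩
  filter_upwards [ae_eq_zero_of_inner_iterate_const hT hwm hnorm hinner
    (fun k => by simpa only [hin2] using hc k) hzero] with x hx
  filter_upwards [hΦae x, Lp.coeFn_zero ℝ 2 lam] with y hy hy0
  rw [← hy, hx, hy0, Pi.zero_apply]

end Correlations

/-! ### Hereditary independence for joinings that need not be ergodic -/

section HereditaryIndependence

variable {Ω Z : Type*} [MeasurableSpace Ω] [MeasurableSpace Z]

/-- Ergodic measures are extreme: in a decomposition of an ergodic measure into invariant measures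
almost all components coincide with it. -/
theorem ae_eq_of_bind_eq_of_ergodic [MeasurableSpace.CountablyGenerated Z] {P : Measure Ω}
    [IsProbabilityMeasure P] {κ : Kernel Ω Z} [IsMarkovKernel κ] {R : Z → Z} {ν : Measure Z}
    [IsProbabilityMeasure ν] (hν : Ergodic R ν) (hκ : P.bind κ = ν)
    (hR : ∀ᵐ ω ∂P, MeasurePreserving R (κ ω) (κ ω)) : ∀ᵐ ω ∂P, κ ω = ν := by
  have key : ∀ B, MeasurableSet B → ∀ᵐ ω ∂P, κ ω B = ν B := by
    intro B hB
    refine ae_eq_of_forall_setLIntegral_eq_of_sigmaFinite (κ.measurable_coe hB)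
      measurable_const fun Q hQ _ => ?_
    -- The components over `Q` add up to an invariant measure dominated by `ν`; by ergodicity it is
    -- a multiple of `ν`, and the total mass identifies the factor as `P Q`.
    set νQ := (P.restrict Q).bind κ with hνQ
    have happ : ∀ E, MeasurableSet E → νQ E = ∫⁻ ω in Q, κ ω E ∂P := fun E hE =>
      Measure.bind_apply hE κ.aemeasurable
    have hinv : MeasurePreserving R νQ νQ := by
      refine ⟨hν.measurable, ?_⟩
      ext E hE
      rw [Measure.map_apply hν.measurable hE, happ E hE, happ _ (hν.measurable hE)]
      refine lintegral_congr_ae (ae_restrict_of_ae ?_)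
      filter_upwards [hR] with ω hω using hω.measure_preimage hE.nullMeasurableSet
    have hac : νQ ≪ ν := by
      refine Measure.AbsolutelyContinuous.mk fun E hE h0 => ?_
      rw [happ E hE]
      rw [← hκ, Measure.bind_apply hE κ.aemeasurable] at h0
      exact le_antisymm ((setLIntegral_le_lintegral _ _).trans_eq h0) zero_le
    have huniv : νQ Set.univ = P Q := by simp [happ _ MeasurableSet.univ]
    have : IsFiniteMeasure νQ := ⟨by rw [huniv]; finiteness⟩
    obtain ⟨c, hc⟩ := hν.eq_smul_of_absolutelyContinuous hinv hac
    have hcP : c = P Q := by rw [← huniv, hc]; simp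
    rw [← happ B hB, hc, hcP, setLIntegral_const, Measure.smul_apply, smul_eq_mul, mul_comm]
  set 𝒜 := generateSetAlgebra (MeasurableSpace.countableGeneratingSet Z)
  have h𝒜c : 𝒜.Countable :=
    countable_generateSetAlgebra (MeasurableSpace.countable_countableGeneratingSet)
  have h𝒜 : ‹MeasurableSpace Z› = MeasurableSpace.generateFrom 𝒜 := by
    rw [generateFrom_generateSetAlgebra_eq,
      MeasurableSpace.generateFrom_countableGeneratingSet]
  have h𝒜m : ∀ B ∈ 𝒜, MeasurableSet B := fun B hB =>
    h𝒜.symm ▸ MeasurableSpace.measurableSet_generateFrom hB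
  filter_upwards [(ae_ball_iff h𝒜c).2 fun B hB => key B (h𝒜m B hB)] with ω hω
  exact ext_of_generate_finite 𝒜 h𝒜
    (fun s hs t ht _ => isSetAlgebra_generateSetAlgebra.inter_mem hs ht) hω (by simp)

variable {X : Type*} [MeasurableSpace X]

theorem measurable_cubeMap {T : X → X} (hT : Measurable T) (n : ℕ) : Measurable (cubeMap T n) :=
  measurable_pi_lambda _ fun i => hT.comp (measurable_pi_apply i)

theorem measurePreserving_face {T : X → X} (hT : Measurable T) {n : ℕ} {ν : Measure (Fin n → X)}
    (hν : MeasurePreserving (cubeMap T n) ν ν) (i j : Fin n) :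
    MeasurePreserving (Prod.map T T) (face ν i j) (face ν i j) := by
  have hm := measurable_face (X := X) i j
  refine ⟨hT.prodMap hT, ?_⟩
  conv_rhs => rw [face, ← hν.map_eq, Measure.map_map hm hν.measurable]
  rw [face, Measure.map_map (hT.prodMap hT) hm]
  rfl

theorem map_fst_face {n : ℕ} (ν : Measure (Fin n → X)) (i j : Fin n) :
    (face ν i j).map Prod.fst = ν.map fun x => x i := by
  rw [face, Measure.map_map measurable_fst (measurable_face i j)]
  rfl

theorem map_snd_face {n : ℕ} (ν : Measure (Fin n → X)) (i j : Fin n) :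
    (face ν i j).map Prod.snd = ν.map fun x => x j := by
  rw [face, Measure.map_map measurable_snd (measurable_face i j)]
  rfl

/-- The hereditary independence property extends to joinings which are not ergodic. -/
theorem HasHI.map_eq_prod [StandardBorelSpace X] {μ : Measure X} [IsProbabilityMeasure μ]
    {T : X → X} (hT : Measurable T) (hwm : IsWeaklyMixing μ T) (hHI : HasHI μ T)
    {η : Measure (Fin 3 → X)} [IsProbabilityMeasure η]
    (hη : MeasurePreserving (cubeMap T 3) η η) (h01 : face η 0 1 = μ.prod μ)
    (h02 : face η 0 2 = μ.prod μ) :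
    η.map (fun x => (x 0, (x 1, x 2))) = μ.prod (face η 1 2) := by
  obtain ⟨κ, hκ, hbind, herg⟩ := exists_ergodic_decomposition hη
  -- The faces of the components decompose `μ ⊗ μ`, which is ergodic by weak mixing.
  have hface : ∀ j, face η 0 j = μ.prod μ → ∀ᵐ ω ∂η, face (κ ω) 0 j = μ.prod μ := by
    intro j hj
    have hm := measurable_face (X := X) (0 : Fin 3) j
    have : IsMarkovKernel (κ.map fun x : Fin 3 → X => (x 0, x j)) := Kernel.IsMarkovKernel.map _ hm
    have hb : η.bind (κ.map fun x : Fin 3 → X => (x 0, x j)) = μ.prod μ := by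
      rw [← hj]
      ext E hE
      rw [Measure.bind_apply hE (Kernel.aemeasurable _), face, Measure.map_apply hm hE]
      conv_rhs => rw [← hbind, Measure.bind_apply (hm hE) κ.aemeasurable]
      refine lintegral_congr fun ω => ?_
      rw [Kernel.map_apply' _ hm _ hE]
    have hinv : ∀ᵐ ω ∂η, MeasurePreserving (Prod.map T T)
        (κ.map (fun x : Fin 3 → X => (x 0, x j)) ω) (κ.map (fun x : Fin 3 → X => (x 0, x j)) ω) := by
      filter_upwards [herg] with ω hω
      rw [Kernel.map_apply _ hm]
      exact measurePreserving_face hT hω.toMeasurePreserving 0 j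
    filter_upwards [ae_eq_of_bind_eq_of_ergodic hwm hb hinv] with ω hω
    rwa [Kernel.map_apply _ hm] at hω
  have hcomp : ∀ᵐ ω ∂η, (κ ω).map (fun x => (x 0, (x 1, x 2))) = μ.prod (face (κ ω) 1 2) := by
    filter_upwards [herg, hface 1 h01, hface 2 h02] with ω h0 h1 h2
    refine hHI (κ ω) ⟨⟨inferInstance, h0.toMeasurePreserving, ?_⟩, h0⟩ h1 h2
    intro i
    fin_cases i
    · exact (map_fst_face (κ ω) 0 1).symm.trans (by rw [h1]; exact Measure.map_fst_prod.trans (by simp))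
    · exact (map_snd_face (κ ω) 0 1).symm.trans (by rw [h1]; exact Measure.map_snd_prod.trans (by simp))
    · exact (map_snd_face (κ ω) 0 2).symm.trans (by rw [h2]; exact Measure.map_snd_prod.trans (by simp))
  have hm : Measurable fun x : Fin 3 → X => (x 0, (x 1, x 2)) := by fun_prop
  have hm12 := measurable_face (X := X) (1 : Fin 3) 2
  have := Measure.isProbabilityMeasure_map (μ := η) hm.aemeasurable
  have : IsProbabilityMeasure (face η 1 2) := Measure.isProbabilityMeasure_map hm12.aemeasurable
  refine Measure.ext_prod fun {A C} hA hC => ?_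
  rw [Measure.prod_prod, Measure.map_apply hm (hA.prod hC), face, Measure.map_apply hm12 hC]
  conv_lhs => rw [← hbind, Measure.bind_apply (hm (hA.prod hC)) κ.aemeasurable]
  conv_rhs => rw [← hbind, Measure.bind_apply (hm12 hC) κ.aemeasurable]
  rw [← lintegral_const_mul _ (κ.measurable_coe (hm12 hC))]
  refine lintegral_congr_ae ?_
  filter_upwards [hcomp] with ω hω
  have : IsProbabilityMeasure (face (κ ω) 1 2) :=
    Measure.isProbabilityMeasure_map hm12.aemeasurable
  rw [← Measure.map_apply hm (hA.prod hC), hω, Measure.prod_prod, face,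
    Measure.map_apply hm12 hC]

/-- The hereditary independence property for measures on `X × X × X`. -/
theorem HasHI.eq_prod [StandardBorelSpace X] {μ : Measure X} [IsProbabilityMeasure μ]
    {T : X → X} (hT : Measurable T) (hwm : IsWeaklyMixing μ T) (hHI : HasHI μ T)
    {θ : Measure (X × X × X)} [IsProbabilityMeasure θ]
    (hθ : MeasurePreserving (Prod.map T (Prod.map T T)) θ θ)
    (h1 : θ.map (fun p => (p.1, p.2.1)) = μ.prod μ)
    (h2 : θ.map (fun p => (p.1, p.2.2)) = μ.prod μ) : θ = μ.prod θ.snd := by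
  have hv : Measurable fun p : X × X × X => (![p.1, p.2.1, p.2.2] : Fin 3 → X) := by
    refine measurable_pi_lambda _ fun i => ?_
    fin_cases i
    · exact measurable_fst
    · exact measurable_snd.fst
    · exact measurable_snd.snd
  set η := θ.map fun p => (![p.1, p.2.1, p.2.2] : Fin 3 → X) with hη
  have : IsProbabilityMeasure η := Measure.isProbabilityMeasure_map hv.aemeasurable
  have hinv : MeasurePreserving (cubeMap T 3) η η := by
    refine ⟨measurable_cubeMap hT 3, ?_⟩
    conv_rhs => rw [hη, ← hθ.map_eq, Measure.map_map hv hθ.measurable]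
    rw [hη, Measure.map_map (measurable_cubeMap hT 3) hv]
    congr 1
    funext p i
    fin_cases i <;> rfl
  have h01 : face η 0 1 = μ.prod μ := by
    rw [face, hη, Measure.map_map (measurable_face _ _) hv, ← h1]; rfl
  have h02 : face η 0 2 = μ.prod μ := by
    rw [face, hη, Measure.map_map (measurable_face _ _) hv, ← h2]; rfl
  have h12 : face η 1 2 = θ.snd := by
    rw [face, hη, Measure.map_map (measurable_face _ _) hv]; rfl
  have := hHI.map_eq_prod hT hwm hinv h01 h02
  rw [h12, hη, Measure.map_map (by fun_prop) hv] at this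
  rw [← this]
  exact Measure.map_id.symm

end HereditaryIndependence

/-! ### Conditional laws and pairwise independent triples -/

section Independence

variable {X Y : Type*} [MeasurableSpace X] [MeasurableSpace Y]

theorem exists_measurableEquiv_iterate (T : X ≃ᵐ X) (k : ℕ) : ∃ V : X ≃ᵐ X, ⇑V = T^[k] := by
  induction k with
  | zero => exact ⟨MeasurableEquiv.refl X, rfl⟩
  | succ k ih =>
    obtain ⟨V, hV⟩ := ih
    exact ⟨T.trans V, by rw [MeasurableEquiv.coe_trans, hV, Function.iterate_succ]⟩

/-- The law of `(x, z, z')` where `(x, y)` is distributed according to `m`, and given `(x, y)` the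
points `z` and `z'` are independent with laws `K (x, y)` and `K (V x, y)`. -/
noncomputable def pairLaw (m : Measure (X × Y)) (K : Kernel (X × Y) X) (V : X ≃ᵐ X) :
    Measure (X × X × X) :=
  (m ⊗ₘ (K ×ₖ K.comap (Prod.map V id) (V.measurable.prodMap measurable_id))).map
    fun q => (q.1.1, q.2)

theorem measurable_pairLaw_map :
    Measurable fun q : (X × Y) × (X × X) => (q.1.1, q.2) := by fun_prop

instance (m : Measure (X × Y)) [IsProbabilityMeasure m] (K : Kernel (X × Y) X) [IsMarkovKernel K]
    (V : X ≃ᵐ X) : IsProbabilityMeasure (pairLaw m K V) :=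
  Measure.isProbabilityMeasure_map measurable_pairLaw_map.aemeasurable

theorem pairLaw_prod (m : Measure (X × Y)) [IsProbabilityMeasure m] (K : Kernel (X × Y) X)
    [IsMarkovKernel K] (V : X ≃ᵐ X) {A B C : Set X} (hA : MeasurableSet A)
    (hB : MeasurableSet B) (hC : MeasurableSet C) :
    pairLaw m K V (A ×ˢ B ×ˢ C) =
      ∫⁻ p in Prod.fst ⁻¹' A, K p B * K (V p.1, p.2) C ∂m := by
  have hset : (fun q : (X × Y) × (X × X) => (q.1.1, q.2)) ⁻¹' (A ×ˢ B ×ˢ C) =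
      (Prod.fst ⁻¹' A) ×ˢ (B ×ˢ C) := by
    ext q
    simp
  rw [pairLaw, Measure.map_apply measurable_pairLaw_map (hA.prod (hB.prod hC)), hset,
    Measure.compProd_apply_prod (measurable_fst hA) (hB.prod hC)]
  refine lintegral_congr fun p => ?_
  rw [Kernel.prod_apply, Measure.prod_prod, Kernel.comap_apply]
  rfl

/-- The disintegration of an invariant measure is equivariant. -/
theorem ae_condKernel_equivariant {Z : Type*} [MeasurableSpace Z] [StandardBorelSpace X]
    [Nonempty X] {π : Measure (Z × X)} [IsProbabilityMeasure π] {R : Z ≃ᵐ Z} {T : X ≃ᵐ X}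
    (hπ : MeasurePreserving (Prod.map R T) π π) {B : Set X} (hB : MeasurableSet B) :
    ∀ᵐ p ∂π.fst, π.condKernel p (T ⁻¹' B) = π.condKernel (R p) B := by
  have hR : MeasurePreserving R π.fst π.fst := by
    refine ⟨R.measurable, ?_⟩
    conv_rhs => rw [← hπ.map_eq]
    rw [Measure.fst, Measure.fst, Measure.map_map R.measurable measurable_fst,
      Measure.map_map measurable_fst hπ.measurable]
    rfl
  have hrect : ∀ {E : Set Z} {C : Set X}, MeasurableSet E → MeasurableSet C →
      ∫⁻ p in E, π.condKernel p C ∂π.fst = π (E ×ˢ C) := by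
    intro E C hE hC
    conv_rhs => rw [← π.disintegrate π.condKernel, Measure.compProd_apply_prod hE hC]
  refine ae_eq_of_forall_setLIntegral_eq_of_sigmaFinite
    (π.condKernel.measurable_coe (T.measurable hB))
    ((π.condKernel.measurable_coe hB).comp R.measurable) fun E hE _ => ?_
  rw [hrect hE (T.measurable hB)]
  have hE' : E = R ⁻¹' (R.symm ⁻¹' E) := by
    ext z; simp
  have h2 : ∫⁻ p in E, π.condKernel (R p) B ∂π.fst =
      ∫⁻ p in R.symm ⁻¹' E, π.condKernel p B ∂π.fst := by
    conv_lhs => rw [hE']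
    exact hR.setLIntegral_comp_preimage (R.symm.measurable hE) (π.condKernel.measurable_coe hB)
  change _ = ∫⁻ p in E, π.condKernel (R p) B ∂π.fst
  rw [h2, hrect (R.symm.measurable hE) hB,
    ← hπ.measure_preimage ((R.symm.measurable hE).prod hB).nullMeasurableSet]
  congr 1
  ext ⟨z, x⟩
  simp

theorem setLIntegral_prod_fst {μ : Measure X} [SFinite μ] {lam : Measure Y} [SFinite lam]
    {f : X × Y → ℝ≥0∞} (hf : Measurable f) (A : Set X) :
    ∫⁻ p in Prod.fst ⁻¹' A, f p ∂(μ.prod lam) = ∫⁻ x in A, ∫⁻ y, f (x, y) ∂lam ∂μ := by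
  rw [← Set.prod_univ, ← Measure.prod_restrict, Measure.restrict_univ,
    lintegral_prod _ hf.aemeasurable]

variable [StandardBorelSpace X] [Nonempty X] {μ : Measure X} [IsProbabilityMeasure μ]
  {lam : Measure Y} [IsProbabilityMeasure lam] {T : X ≃ᵐ X} {R : Y ≃ᵐ Y}
  {π : Measure ((X × Y) × X)} [IsProbabilityMeasure π]

/-- The conditional law is equivariant under `T × R`. As `V` commutes with `T`, so is its translate
`K (V x, y)`. -/
theorem measurePreserving_pairLaw (hT : MeasurePreserving T μ μ) (hR : MeasurePreserving R lam lam)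
    (hπ : MeasurePreserving (Prod.map (Prod.map T R) T) π π) (h1 : π.fst = μ.prod lam)
    {V : X ≃ᵐ X} (hV : MeasurePreserving V μ μ) (hVT : ∀ x, V (T x) = T (V x)) :
    MeasurePreserving (Prod.map T (Prod.map T T)) (pairLaw (μ.prod lam) π.condKernel V)
      (pairLaw (μ.prod lam) π.condKernel V) := by
  have hTm : Measurable (Prod.map T (Prod.map T T)) :=
    T.measurable.prodMap (T.measurable.prodMap T.measurable)
  have hequiv : ∀ {B}, MeasurableSet B → ∀ᵐ p ∂(μ.prod lam),
      π.condKernel p (T ⁻¹' B) = π.condKernel (T p.1, R p.2) B := by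
    intro B hB
    rw [← h1]
    exact ae_condKernel_equivariant (R := T.prodCongr R) hπ hB
  refine ⟨hTm, ?_⟩
  have := Measure.isProbabilityMeasure_map (μ := pairLaw (μ.prod lam) π.condKernel V)
    hTm.aemeasurable
  refine Measure.ext_prod₃ fun {A B C} hA hB hC => ?_
  rw [Measure.map_apply hTm (hA.prod (hB.prod hC))]
  change pairLaw (μ.prod lam) π.condKernel V ((T ⁻¹' A) ×ˢ (T ⁻¹' B) ×ˢ (T ⁻¹' C)) = _
  rw [pairLaw_prod _ _ _ (T.measurable hA) (T.measurable hB) (T.measurable hC),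
    pairLaw_prod _ _ _ hA hB hC]
  have hTR := hT.prod hR
  have hVid : MeasurePreserving (Prod.map V id) (μ.prod lam) (μ.prod lam) :=
    hV.prod (MeasurePreserving.id lam)
  have hmeas : Measurable fun p : X × Y => π.condKernel p B * π.condKernel (V p.1, p.2) C :=
    (π.condKernel.measurable_coe hB).mul
      ((π.condKernel.measurable_coe hC).comp hVid.measurable)
  rw [← hTR.setLIntegral_comp_preimage (measurable_fst hA) hmeas]
  refine lintegral_congr_ae (ae_restrict_of_ae ?_)
  filter_upwards [hequiv hB, hVid.quasiMeasurePreserving.ae (hequiv hC)] with p hp hp'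
  have hp'' : π.condKernel (V p.1, p.2) (T ⁻¹' C) = π.condKernel (T (V p.1), R p.2) C := hp'
  simp only [Prod.map_fst, Prod.map_snd]
  rw [hp, hVT, hp'']
  rfl

omit [IsProbabilityMeasure lam] in
theorem setLIntegral_condKernel (h1 : π.fst = μ.prod lam)
    (h3 : π.map (fun p => (p.1.1, p.2)) = μ.prod μ) {A B : Set X} (hA : MeasurableSet A)
    (hB : MeasurableSet B) :
    ∫⁻ p in Prod.fst ⁻¹' A, π.condKernel p B ∂(μ.prod lam) = μ A * μ B := by
  rw [← h1, ← Measure.compProd_apply_prod (measurable_fst hA) hB, π.disintegrate π.condKernel,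
    ← Measure.prod_prod, ← h3, Measure.map_apply (by fun_prop) (hA.prod hB)]
  rfl

theorem pairLaw_map_fst (h1 : π.fst = μ.prod lam)
    (h3 : π.map (fun p => (p.1.1, p.2)) = μ.prod μ) (V : X ≃ᵐ X) :
    (pairLaw (μ.prod lam) π.condKernel V).map (fun p => (p.1, p.2.1)) = μ.prod μ := by
  have hm : Measurable fun p : X × X × X => (p.1, p.2.1) := by fun_prop
  have := Measure.isProbabilityMeasure_map (μ := pairLaw (μ.prod lam) π.condKernel V)
    hm.aemeasurable
  refine Measure.ext_prod fun {A B} hA hB => ?_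
  rw [Measure.map_apply hm (hA.prod hB), Measure.prod_prod,
    ← setLIntegral_condKernel h1 h3 hA hB]
  have : (fun p : X × X × X => (p.1, p.2.1)) ⁻¹' A ×ˢ B = A ×ˢ B ×ˢ Set.univ := by
    ext; simp
  rw [this, pairLaw_prod _ _ _ hA hB .univ]
  simp

/-- The pair `(V x, z')` is distributed like the first and last coordinates under `π`; invertibility
of `V` carries its independence back to `x`. -/
theorem pairLaw_map_snd (h1 : π.fst = μ.prod lam)
    (h3 : π.map (fun p => (p.1.1, p.2)) = μ.prod μ) {V : X ≃ᵐ X} (hV : MeasurePreserving V μ μ) :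
    (pairLaw (μ.prod lam) π.condKernel V).map (fun p => (p.1, p.2.2)) = μ.prod μ := by
  have hm : Measurable fun p : X × X × X => (p.1, p.2.2) := by fun_prop
  have := Measure.isProbabilityMeasure_map (μ := pairLaw (μ.prod lam) π.condKernel V)
    hm.aemeasurable
  have hVid : MeasurePreserving (Prod.map V id) (μ.prod lam) (μ.prod lam) :=
    hV.prod (MeasurePreserving.id lam)
  refine Measure.ext_prod fun {A B} hA hB => ?_
  have hset : (fun p : X × X × X => (p.1, p.2.2)) ⁻¹' A ×ˢ B = A ×ˢ Set.univ ×ˢ B := by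
    ext; simp
  have hA' : (Prod.fst ⁻¹' A : Set (X × Y)) =
      Prod.map V id ⁻¹' (Prod.fst ⁻¹' (V.symm ⁻¹' A)) := by
    ext p; simp
  rw [Measure.map_apply hm (hA.prod hB), Measure.prod_prod, hset,
    pairLaw_prod _ _ _ hA .univ hB]
  simp only [measure_univ, one_mul]
  rw [hA']
  have h2 := hVid.setLIntegral_comp_preimage (measurable_fst (V.symm.measurable hA))
    (π.condKernel.measurable_coe hB)
  refine h2.trans ?_
  rw [setLIntegral_condKernel h1 h3 (V.symm.measurable hA) hB,
    ← hV.measure_preimage (V.symm.measurable hA).nullMeasurableSet]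
  congr 2
  ext x; simp

/-- Under hereditary independence the correlations of the conditional probabilities along the
orbits are constant. -/
theorem HasHI.lintegral_condKernel_mul (hT : MeasurePreserving T μ μ) (hwm : IsWeaklyMixing μ T)
    (hHI : HasHI μ T) (hR : MeasurePreserving R lam lam)
    (hπ : MeasurePreserving (Prod.map (Prod.map T R) T) π π) (h1 : π.fst = μ.prod lam)
    (h3 : π.map (fun p => (p.1.1, p.2)) = μ.prod μ) {B : Set X} (hB : MeasurableSet B) (k : ℕ) :
    ∃ c, ∀ᵐ x ∂μ,
      ∫⁻ y, π.condKernel (x, y) B * π.condKernel (T^[k] x, y) B ∂lam = c := by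
  obtain ⟨V, hV⟩ := exists_measurableEquiv_iterate T k
  have hVm : MeasurePreserving V μ μ := by rw [hV]; exact hT.iterate k
  have hVT : ∀ x, V (T x) = T (V x) := fun x => by
    rw [hV, ← Function.iterate_succ_apply, Function.iterate_succ_apply']
  have hprod := hHI.eq_prod T.measurable hwm (measurePreserving_pairLaw hT hR hπ h1 hVm hVT)
    (pairLaw_map_fst h1 h3 V) (pairLaw_map_snd h1 h3 hVm)
  set θ := pairLaw (μ.prod lam) π.condKernel V
  have hmeas : Measurable fun p : X × Y => π.condKernel p B * π.condKernel (V p.1, p.2) B :=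
    (π.condKernel.measurable_coe hB).mul
      ((π.condKernel.measurable_coe hB).comp (V.measurable.prodMap measurable_id))
  -- The constant is the probability that `z` and `z'` both lie in `B`.
  refine ⟨θ.snd (B ×ˢ B), ?_⟩
  rw [← hV]
  refine ae_eq_of_forall_setLIntegral_eq_of_sigmaFinite hmeas.lintegral_prod_right'
    measurable_const fun A hA _ => ?_
  rw [← setLIntegral_prod_fst hmeas A, ← pairLaw_prod _ _ _ hA hB hB, setLIntegral_const]
  change θ _ = _
  conv_lhs => rw [hprod, Measure.prod_prod]
  rw [mul_comm]

/-- Apply the vanishing criterion to `K (x, y) B - μ B`. Independence of `x` and `z` gives its mean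
over `y`, so that centring keeps the correlations constant; independence of `y` and `z` gives mean
zero over `x`. -/
theorem HasHI.ae_condKernel_eq [MeasurableSpace.CountablyGenerated Y]
    (hT : MeasurePreserving T μ μ) (hwm : IsWeaklyMixing μ T)
    (hHI : HasHI μ T) (hR : MeasurePreserving R lam lam)
    (hπ : MeasurePreserving (Prod.map (Prod.map T R) T) π π) (h1 : π.fst = μ.prod lam)
    (h2 : π.map (fun p => (p.1.2, p.2)) = lam.prod μ)
    (h3 : π.map (fun p => (p.1.1, p.2)) = μ.prod μ) {B : Set X} (hB : MeasurableSet B) :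
    ∀ᵐ p ∂(μ.prod lam), π.condKernel p B = μ B := by
  set u : X → Y → ℝ := fun x y => (π.condKernel (x, y)).real B with hu
  have hum : Measurable (Function.uncurry u) := (π.condKernel.measurable_coe hB).ennreal_toReal
  have hu0 : ∀ x y, 0 ≤ u x y := fun x y => measureReal_nonneg
  have hu1 : ∀ x y, u x y ≤ 1 := fun x y => measureReal_le_one
  have hux : ∀ x, Measurable (u x) := fun x => hum.comp measurable_prodMk_left
  have huy : ∀ y, Measurable fun x => u x y := fun y => hum.comp measurable_prodMk_right
  have hb0 : 0 ≤ μ.real B := measureReal_nonneg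
  have hb1 : μ.real B ≤ 1 := measureReal_le_one
  have hofu : ∀ x y, ENNReal.ofReal (u x y) = π.condKernel (x, y) B := fun x y => by
    rw [hu]; exact ENNReal.ofReal_toReal (by finiteness)
  have hint : ∀ x, Integrable (u x) lam := fun x =>
    Integrable.of_bound (C := 1) (hux x).aestronglyMeasurable (ae_of_all _ fun y => by
      rw [Real.norm_of_nonneg (hu0 x y)]; exact hu1 x y)
  have hint' : ∀ y, Integrable (fun x => u x y) μ := fun y =>
    Integrable.of_bound (C := 1) (huy y).aestronglyMeasurable (ae_of_all _ fun x => by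
      rw [Real.norm_of_nonneg (hu0 x y)]; exact hu1 x y)
  have hint2 : ∀ x x', Integrable (fun y => u x y * u x' y) lam := fun x x' =>
    Integrable.of_bound (C := 1) ((hux x).mul (hux x')).aestronglyMeasurable
      (ae_of_all _ fun y => by
        rw [Real.norm_of_nonneg (mul_nonneg (hu0 x y) (hu0 x' y))]
        exact mul_le_one₀ (hu1 x y) (hu0 x' y) (hu1 x' y))
  have hxmean : ∀ᵐ x ∂μ, ∫ y, u x y ∂lam = μ.real B := by
    have : ∀ᵐ x ∂μ, ∫⁻ y, π.condKernel (x, y) B ∂lam = μ B := by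
      refine ae_eq_of_forall_setLIntegral_eq_of_sigmaFinite
        (π.condKernel.measurable_coe hB).lintegral_prod_right' measurable_const fun A hA _ => ?_
      rw [← setLIntegral_prod_fst (π.condKernel.measurable_coe hB) A,
        setLIntegral_condKernel h1 h3 hA hB, setLIntegral_const, mul_comm]
    filter_upwards [this] with x hx
    rw [integral_eq_lintegral_of_nonneg_ae (ae_of_all _ (hu0 x)) (hux x).aestronglyMeasurable]
    simp_rw [hofu, hx]
    rfl
  have hymean : ∀ᵐ y ∂lam, ∫ x, u x y ∂μ = μ.real B := by
    have : ∀ᵐ y ∂lam, ∫⁻ x, π.condKernel (x, y) B ∂μ = μ B := by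
      refine ae_eq_of_forall_setLIntegral_eq_of_sigmaFinite
        (π.condKernel.measurable_coe hB).lintegral_prod_left' measurable_const fun E hE _ => ?_
      have hf : Measurable fun p : X × Y => (π.condKernel p) B := π.condKernel.measurable_coe hB
      have h4 : ∫⁻ p in Prod.snd ⁻¹' E, π.condKernel p B ∂(μ.prod lam) =
          ∫⁻ y in E, ∫⁻ x, π.condKernel (x, y) B ∂μ ∂lam := by
        rw [← Set.univ_prod, ← Measure.prod_restrict, Measure.restrict_univ,
          lintegral_prod_symm _ hf.aemeasurable]
      rw [← h4, ← h1, ← Measure.compProd_apply_prod (measurable_snd hE) hB,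
        π.disintegrate π.condKernel, setLIntegral_const, mul_comm, ← Measure.prod_prod, ← h2,
        Measure.map_apply (by fun_prop) (hE.prod hB)]
      rfl
    filter_upwards [this] with y hy
    rw [integral_eq_lintegral_of_nonneg_ae (ae_of_all _ fun x => hu0 x y)
      (huy y).aestronglyMeasurable]
    simp_rw [hofu, hy]
    rfl
  have hzero : ∀ᵐ x ∂μ, ∀ᵐ y ∂lam, u x y - μ.real B = 0 := by
    refine ae_eq_zero_of_correlation_const hT hwm (F := fun x y => u x y - μ.real B)
      (hum.sub_const _) (fun x y => ?_) (fun k => ?_) ?_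
    · rw [Real.norm_eq_abs, abs_le]
      have := hu0 x y
      have := hu1 x y
      constructor <;> linarith
    · obtain ⟨c, hc⟩ := hHI.lintegral_condKernel_mul hT hwm hR hπ h1 h3 hB k
      refine ⟨c.toReal - μ.real B * μ.real B, ?_⟩
      filter_upwards [hc, hxmean, (hT.iterate k).quasiMeasurePreserving.ae hxmean]
        with x hx hx1 hx2
      have hcorr : ∫ y, u x y * u (T^[k] x) y ∂lam = c.toReal := by
        rw [integral_eq_lintegral_of_nonneg_ae
          (ae_of_all _ fun y => mul_nonneg (hu0 _ y) (hu0 _ y))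
          ((hux x).mul (hux _)).aestronglyMeasurable]
        simp_rw [ENNReal.ofReal_mul (hu0 _ _), hofu, hx]
      have hexp : ∀ y, (u x y - μ.real B) * (u (T^[k] x) y - μ.real B) =
          (u x y * u (T^[k] x) y - μ.real B * u x y) -
            (μ.real B * u (T^[k] x) y - μ.real B * μ.real B) := fun y => by ring
      have i1 : Integrable (fun y => μ.real B * u x y) lam := (hint x).const_mul _
      have i2 : Integrable (fun y => μ.real B * u (T^[k] x) y) lam := (hint _).const_mul _
      have i3 : Integrable (fun _ : Y => μ.real B * μ.real B) lam := integrable_const _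
      have i4 : Integrable (fun y => u x y * u (T^[k] x) y - μ.real B * u x y) lam :=
        (hint2 _ _).sub i1
      have i5 : Integrable (fun y => μ.real B * u (T^[k] x) y - μ.real B * μ.real B) lam :=
        i2.sub i3
      simp_rw [hexp]
      rw [integral_sub i4 i5, integral_sub (hint2 _ _) i1, integral_sub i2 i3,
        integral_const_mul, integral_const_mul, hcorr, hx1, hx2]
      simp
    · filter_upwards [hymean] with y hy
      rw [integral_sub (hint' y) (integrable_const _), hy]
      simp
  have hms : MeasurableSet {p : X × Y | π.condKernel p B = μ B} :=
    π.condKernel.measurable_coe hB (measurableSet_singleton _)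
  rw [Measure.ae_prod_iff_ae_ae hms]
  filter_upwards [hzero] with x hx
  filter_upwards [hx] with y hy
  have : u x y = μ.real B := sub_eq_zero.1 hy
  exact (ENNReal.toReal_eq_toReal_iff' (by finiteness) (by finiteness)).1 this

/-- Under hereditary independence, a joining of `T`, a system `R` and `T` whose two-dimensional
marginals are products is a product. -/
theorem HasHI.eq_prod_prod [MeasurableSpace.CountablyGenerated Y]
    (hT : MeasurePreserving T μ μ) (hwm : IsWeaklyMixing μ T)
    (hHI : HasHI μ T) (hR : MeasurePreserving R lam lam)
    (hπ : MeasurePreserving (Prod.map (Prod.map T R) T) π π) (h1 : π.fst = μ.prod lam)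
    (h2 : π.map (fun p => (p.1.2, p.2)) = lam.prod μ)
    (h3 : π.map (fun p => (p.1.1, p.2)) = μ.prod μ) : π = (μ.prod lam).prod μ := by
  refine Measure.ext_prod fun {E B} hE hB => ?_
  rw [Measure.prod_prod]
  conv_lhs => rw [← π.disintegrate π.condKernel, Measure.compProd_apply_prod hE hB, h1]
  rw [setLIntegral_congr_fun_ae hE (g := fun _ => μ B)
    ((hHI.ae_condKernel_eq hT hwm hR hπ h1 h2 h3 hB).mono fun p hp _ => hp),
    setLIntegral_const, mul_comm]

end Independence

/-! ### Joinings of any order -/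

section Joinings

variable {X : Type*} [MeasurableSpace X] {μ : Measure X}

theorem measurable_reindex {m n : ℕ} (σ : Fin m → Fin n) :
    Measurable fun (x : Fin n → X) i => x (σ i) :=
  measurable_pi_lambda _ fun i => measurable_pi_apply (σ i)

theorem IsJoining.reindex {T : X → X} (hT : Measurable T) {m n : ℕ} {ν : Measure (Fin n → X)}
    (hν : IsJoining μ T ν) (σ : Fin m → Fin n) :
    IsJoining μ T (ν.map fun x i => x (σ i)) where
  isProbabilityMeasure := by
    have := hν.isProbabilityMeasure
    exact Measure.isProbabilityMeasure_map (measurable_reindex σ).aemeasurable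
  measurePreserving := by
    refine ⟨measurable_cubeMap hT m, ?_⟩
    conv_rhs => rw [← hν.measurePreserving.map_eq,
      Measure.map_map (measurable_reindex σ) hν.measurePreserving.measurable]
    rw [Measure.map_map (measurable_cubeMap hT m) (measurable_reindex σ)]
    rfl
  marginal i := by
    rw [Measure.map_map (measurable_pi_apply i) (measurable_reindex σ)]
    exact hν.marginal (σ i)

theorem IsErgodicJoining.reindex {T : X → X} (hT : Measurable T) {m n : ℕ}
    {ν : Measure (Fin n → X)} (hν : IsErgodicJoining μ T ν) (σ : Fin m → Fin n) :
    IsErgodicJoining μ T (ν.map fun x i => x (σ i)) where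
  toIsJoining := hν.toIsJoining.reindex hT σ
  ergodic := by
    have h := hν.toIsJoining.reindex hT σ
    exact MeasurePreserving.ergodic_of_ergodic_semiconj ⟨measurable_reindex σ, rfl⟩ hν.ergodic
      h.measurePreserving.measurable fun _ => rfl

theorem face_reindex {m n : ℕ} (ν : Measure (Fin n → X)) (σ : Fin m → Fin n) (i j : Fin m) :
    face (ν.map fun x i => x (σ i)) i j = face ν (σ i) (σ j) := by
  rw [face, Measure.map_map (measurable_face i j) (measurable_reindex σ)]
  rfl

theorem map_pi_head_tail [SigmaFinite μ] (n : ℕ) :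
    (Measure.pi fun _ : Fin (n + 1) => μ).map (fun w => (w 0, fun i : Fin n => w i.succ)) =
      μ.prod (Measure.pi fun _ => μ) := by
  have h := (measurePreserving_piFinSuccAbove (fun _ : Fin (n + 1) => μ) 0).map_eq
  rw [← h]
  rfl

theorem map_pi_init_last [SigmaFinite μ] (n : ℕ) :
    (Measure.pi fun _ : Fin (n + 1) => μ).map
      (fun w => ((fun i : Fin n => w i.castSucc), w (Fin.last n))) =
      (Measure.pi fun _ => μ).prod μ := by
  have h := (measurePreserving_piFinSuccAbove (fun _ : Fin (n + 1) => μ) (Fin.last n)).map_eq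
  have h2 := congrArg (fun m => m.map Prod.swap) h
  simp only [Measure.map_map measurable_swap
    (MeasurableEquiv.piFinSuccAbove (fun _ : Fin (n + 1) => X) (Fin.last n)).measurable,
    Measure.prod_swap] at h2
  rw [← h2]
  congr 1
  funext w
  refine Prod.ext ?_ rfl
  funext i
  simp [MeasurableEquiv.piFinSuccAbove, Fin.init]

theorem eq_pi_of_map_eq_prod [IsProbabilityMeasure μ] {n : ℕ} {ν : Measure (Fin (n + 2) → X)}
    (h : ν.map (fun x => ((x 0, fun i : Fin n => x i.castSucc.succ), x (Fin.last (n + 1)))) =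
      (μ.prod (Measure.pi fun _ => μ)).prod μ) : ν = Measure.pi fun _ => μ := by
  refine (Measure.pi_eq fun s hs => ?_).symm
  have hm : Measurable fun x : Fin (n + 2) → X =>
    ((x 0, fun i : Fin n => x i.castSucc.succ), x (Fin.last (n + 1))) := by fun_prop
  set E : Set ((X × (Fin n → X)) × X) :=
    (s 0 ×ˢ Set.univ.pi fun i : Fin n => s i.castSucc.succ) ×ˢ s (Fin.last (n + 1)) with hE
  have hEm : MeasurableSet E :=
    ((hs 0).prod (MeasurableSet.univ_pi fun i => hs _)).prod (hs _)
  have hpre : Set.univ.pi s = (fun x : Fin (n + 2) → X =>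
      ((x 0, fun i : Fin n => x i.castSucc.succ), x (Fin.last (n + 1)))) ⁻¹' E := by
    ext x
    simp only [hE, Set.mem_preimage, Set.mem_prod, Set.mem_univ_pi]
    constructor
    · exact fun hx => ⟨⟨hx 0, fun i => hx _⟩, hx _⟩
    · rintro ⟨⟨h0, hi⟩, hl⟩ j
      induction j using Fin.cases with
      | zero => exact h0
      | succ j =>
        induction j using Fin.lastCases with
        | last => exact hl
        | cast j => exact hi j
  rw [hpre, ← Measure.map_apply hm hEm, h, hE, Measure.prod_prod, Measure.prod_prod,
    Measure.pi_pi, Fin.prod_univ_succ, Fin.prod_univ_castSucc, mul_assoc]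
  rfl

/-- Under hereditary independence, pairwise independent joinings are products. -/
theorem HasHI.eq_pi [StandardBorelSpace X] [IsProbabilityMeasure μ] {T : X ≃ᵐ X}
    (hT : MeasurePreserving T μ μ) (hwm : IsWeaklyMixing μ T) (hHI : HasHI μ T) (n : ℕ)
    {ν : Measure (Fin (n + 1) → X)} (hν : IsJoining μ T ν)
    (hpair : ∀ i j, i < j → face ν i j = μ.prod μ) : ν = Measure.pi fun _ => μ := by
  induction n with
  | zero =>
    refine (Measure.pi_eq fun s hs => ?_).symm
    rw [Fin.prod_univ_one, ← hν.marginal 0, Measure.map_apply (measurable_pi_apply 0) (hs 0)]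
    congr 1
    ext x
    simp only [Set.mem_univ_pi, Set.mem_preimage]
    exact ⟨fun h => h 0, fun h i => by rwa [Fin.fin_one_eq_zero i]⟩
  | succ n ih =>
    have := hν.isProbabilityMeasure
    have : Nonempty X := nonempty_of_isProbabilityMeasure μ
    have hinit := ih (hν.reindex T.measurable Fin.castSucc) fun i j hij => by
      rw [face_reindex]
      exact hpair _ _ (Fin.castSucc_lt_castSucc_iff.2 hij)
    have htail := ih (hν.reindex T.measurable Fin.succ) fun i j hij => by
      rw [face_reindex]
      exact hpair _ _ (Fin.succ_lt_succ_iff.2 hij)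
    have hm : Measurable fun x : Fin (n + 2) → X =>
      ((x 0, fun i : Fin n => x i.castSucc.succ), x (Fin.last (n + 1))) := by fun_prop
    apply eq_pi_of_map_eq_prod
    set π := ν.map fun x => ((x 0, fun i : Fin n => x i.castSucc.succ), x (Fin.last (n + 1)))
      with hπ
    have : IsProbabilityMeasure π := Measure.isProbabilityMeasure_map hm.aemeasurable
    have hcube := measurePreserving_pi (fun _ : Fin n => μ) (fun _ : Fin n => μ) fun _ => hT
    have hTR : Measurable (Prod.map (Prod.map T (cubeMap T n)) T) :=
      (T.measurable.prodMap (measurable_cubeMap T.measurable n)).prodMap T.measurable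
    -- The `n` middle coordinates form one system. Its marginals with the first and with the last
    -- coordinate are products by induction; the extreme pair is a product by hypothesis.
    refine hHI.eq_prod_prod (R := MeasurableEquiv.piCongrRight fun _ : Fin n => T) hT hwm hcube
      ?_ ?_ ?_ ?_
    · refine ⟨hTR, ?_⟩
      conv_rhs => rw [hπ, ← hν.measurePreserving.map_eq,
        Measure.map_map hm hν.measurePreserving.measurable]
      rw [hπ]
      exact Measure.map_map hTR hm
    · rw [← map_pi_head_tail, ← hinit, Measure.map_map (by fun_prop) (measurable_reindex _),
        Measure.fst, hπ, Measure.map_map measurable_fst hm]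
      rfl
    · rw [← map_pi_init_last, ← htail, Measure.map_map (by fun_prop) (measurable_reindex _),
        hπ, Measure.map_map (by fun_prop) hm]
      rfl
    · rw [hπ, Measure.map_map (by fun_prop) hm, ← hpair 0 (Fin.last (n + 1)) (Fin.last_pos)]
      rfl

theorem HasHI.isTensorSimple [StandardBorelSpace X] [IsProbabilityMeasure μ] {T : X ≃ᵐ X}
    (hT : MeasurePreserving T μ μ) (hwm : IsWeaklyMixing μ T) (hHI : HasHI μ T) :
    IsTensorSimple μ T := by
  intro n hn ν hν hpair
  obtain ⟨n, rfl⟩ : ∃ k, n = k + 1 := ⟨n - 1, by omega⟩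
  exact hHI.eq_pi hT hwm n hν hpair

theorem map_pi_head_pair [IsProbabilityMeasure μ] :
    (Measure.pi fun _ : Fin 3 => μ).map (fun x => (x 0, (x 1, x 2))) =
      μ.prod (face (Measure.pi fun _ : Fin 3 => μ) 1 2) := by
  have h1 := map_pi_head_tail (μ := μ) 2
  have hm : Measurable fun q : X × (Fin 2 → X) => (q.1, (q.2 0, q.2 1)) := by fun_prop
  have hm2 : Measurable fun w : Fin 2 → X => (w 0, w 1) := by fun_prop
  have h2 : face (Measure.pi fun _ : Fin 3 => μ) 1 2 =
      (Measure.pi fun _ : Fin 2 => μ).map fun w => (w 0, w 1) := by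
    have h3 := congrArg (fun m => m.map Prod.snd) h1
    simp only [Measure.map_snd_prod, measure_univ, one_smul] at h3
    rw [← h3, Measure.map_map measurable_snd (by fun_prop),
      Measure.map_map hm2 (by fun_prop)]
    rfl
  have := Measure.isProbabilityMeasure_map (μ := Measure.pi fun _ : Fin 2 => μ) hm2.aemeasurable
  rw [h2]
  have h4 := Measure.map_prod_map μ (Measure.pi fun _ : Fin 2 => μ) measurable_id hm2
  rw [Measure.map_id] at h4
  rw [h4, ← h1, Measure.map_map (by fun_prop) (by fun_prop)]
  rfl

/-- Faces equal to `μ ⊗ μ` are not quasi-diagonal unless `μ` is a point mass, so the quasi-diagonal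
face must be the third one. Then `η` is absolutely continuous with respect to an ergodic product,
hence equal to it. -/
theorem IsQuasiSimple.hasHI [StandardBorelSpace X] [IsProbabilityMeasure μ] {T : X ≃ᵐ X}
    (hT : MeasurePreserving T μ μ) (hwm : IsWeaklyMixing μ T) (hQS : IsQuasiSimple μ T 3) :
    HasHI μ T := by
  intro η hη h01 h02
  have := hη.isProbabilityMeasure
  by_cases hpi : η = Measure.pi fun _ => μ
  · rw [hpi]
    exact map_pi_head_pair
  have hdeg : ¬ IsQuasiDiagonal μ (μ.prod μ) := by
    rintro ⟨p, q, hp, -⟩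
    obtain ⟨a, ha⟩ := exists_ae_eq_of_hasUniformFibres_prod hwm hp
    exact hpi (hη.toIsJoining.eq_pi_of_ae_eq ha)
  have h12 : IsQuasiDiagonal μ (face η 1 2) := by
    obtain ⟨i, j, hij, h⟩ := hQS η hη hpi
    fin_cases i <;> fin_cases j <;> simp at hij
    · exact absurd (h01 ▸ h) hdeg
    · exact absurd (h02 ▸ h) hdeg
    · exact h
  obtain ⟨p, q, hp, -⟩ := h12
  have hm : Measurable fun x : Fin 3 → X => (x 0, (x 1, x 2)) := by fun_prop
  have hm12 := measurable_face (X := X) (1 : Fin 3) 2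
  have := Measure.isProbabilityMeasure_map (μ := η) hm.aemeasurable
  have : IsProbabilityMeasure (face η 1 2) := Measure.isProbabilityMeasure_map hm12.aemeasurable
  have herg12 : Ergodic (Prod.map T T) (face η 1 2) :=
    MeasurePreserving.ergodic_of_ergodic_semiconj ⟨hm12, rfl⟩ hη.ergodic
      (T.measurable.prodMap T.measurable) fun _ => rfl
  refine (ergodic_prodMap hT hwm herg12).eq_of_absolutelyContinuous ?_
    (absolutelyContinuous_of_hasUniformFibres h01 hp)
  have hTm : Measurable (Prod.map T (Prod.map T T)) :=
    T.measurable.prodMap (T.measurable.prodMap T.measurable)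
  refine ⟨hTm, ?_⟩
  conv_rhs => rw [← hη.measurePreserving.map_eq, Measure.map_map hm hη.measurePreserving.measurable]
  rw [Measure.map_map hTm hm]
  rfl

/-- The product of a joining of two copies and `μ`, as a joining of three copies. -/
theorem IsErgodicJoining.exists_prod [IsProbabilityMeasure μ] {T : X → X}
    (hT : MeasurePreserving T μ μ) (hwm : IsWeaklyMixing μ T) {ν : Measure (Fin 2 → X)}
    (hν : IsErgodicJoining μ T ν) :
    ∃ η : Measure (Fin 3 → X), IsErgodicJoining μ T η ∧ face η 0 1 = face ν 0 1 ∧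
      face η 0 2 = μ.prod μ ∧ face η 1 2 = μ.prod μ ∧
      η.map (fun x i => x (Fin.castSucc i)) = ν := by
  have := hν.isProbabilityMeasure
  set g : X × (Fin 2 → X) → Fin 3 → X := fun q => ![q.2 0, q.2 1, q.1] with hg
  have hgm : Measurable g := by
    refine measurable_pi_lambda _ fun i => ?_
    fin_cases i
    · exact (measurable_pi_apply (0 : Fin 2)).comp (measurable_snd (α := X))
    · exact (measurable_pi_apply (1 : Fin 2)).comp (measurable_snd (α := X))
    · exact measurable_fst
  have herg := ergodic_prodMap hT hwm hν.ergodic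
  have hη : ∀ i : Fin 2, ((μ.prod ν).map fun q => (q.2 i, q.1)) = μ.prod μ := by
    intro i
    have h := Measure.map_prod_map ν μ (measurable_pi_apply i) measurable_id
    rw [Measure.map_id, hν.marginal i] at h
    rw [h, ← Measure.prod_swap, Measure.map_map (by fun_prop) measurable_swap]
    rfl
  have hTm := measurable_cubeMap hT.measurable 3
  have hcomm : Function.Semiconj g (Prod.map T (cubeMap T 2)) (cubeMap T 3) := by
    intro q
    funext i
    fin_cases i <;> rfl
  have hergη : Ergodic (cubeMap T 3) ((μ.prod ν).map g) :=
    MeasurePreserving.ergodic_of_ergodic_semiconj ⟨hgm, rfl⟩ herg hTm hcomm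
  have h01 : face ((μ.prod ν).map g) 0 1 = face ν 0 1 := by
    rw [face, Measure.map_map (measurable_face _ _) hgm, face]
    conv_rhs => rw [← Measure.snd_prod (μ := μ) (ν := ν), Measure.snd,
      Measure.map_map (measurable_face _ _) measurable_snd]
    rfl
  have h02 : face ((μ.prod ν).map g) 0 2 = μ.prod μ := by
    rw [face, Measure.map_map (measurable_face _ _) hgm, ← hη 0]
    rfl
  have h12 : face ((μ.prod ν).map g) 1 2 = μ.prod μ := by
    rw [face, Measure.map_map (measurable_face _ _) hgm, ← hη 1]
    rfl
  refine ⟨(μ.prod ν).map g, ⟨⟨Measure.isProbabilityMeasure_map hgm.aemeasurable,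
    hergη.toMeasurePreserving, ?_⟩, hergη⟩, h01, h02, h12, ?_⟩
  · have hfst : (μ.prod μ).map Prod.fst = μ := Measure.fst_prod
    have hsnd : (μ.prod μ).map Prod.snd = μ := Measure.snd_prod
    intro i
    fin_cases i
    · exact (map_fst_face _ 0 2).symm.trans (by rw [h02, hfst])
    · exact (map_fst_face _ 1 2).symm.trans (by rw [h12, hfst])
    · exact (map_snd_face _ 1 2).symm.trans (by rw [h12, hsnd])
  · rw [Measure.map_map (measurable_reindex _) hgm]
    conv_rhs => rw [← Measure.snd_prod (μ := μ) (ν := ν), Measure.snd]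
    congr 1
    funext q i
    fin_cases i <;> rfl

theorem pi_reindex_castSucc [IsProbabilityMeasure μ] (n : ℕ) :
    (Measure.pi fun _ : Fin (n + 1) => μ).map (fun x i => x (Fin.castSucc i)) =
      Measure.pi fun _ : Fin n => μ := by
  have h := congrArg Measure.fst (map_pi_init_last (μ := μ) n)
  rw [Measure.fst_prod, Measure.fst, Measure.map_map measurable_fst (by fun_prop)] at h
  exact h

/-- A property of ergodic joinings which holds for some face of every ergodic joining of order
three other than the product, and which implies quasi-diagonality, holds for some face of every
ergodic joining of any order other than the product. -/
theorem exists_face_of_three [StandardBorelSpace X] [IsProbabilityMeasure μ] {T : X ≃ᵐ X}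
    (hT : MeasurePreserving T μ μ) (hwm : IsWeaklyMixing μ T) {p : Measure (X × X) → Prop}
    (hp : ∀ ρ, p ρ → IsQuasiDiagonal μ ρ)
    (h3 : ∀ ν : Measure (Fin 3 → X), IsErgodicJoining μ T ν → ν ≠ Measure.pi (fun _ => μ) →
      ∃ i j : Fin 3, i < j ∧ p (face ν i j))
    {n : ℕ} (hn : 2 ≤ n) (ν : Measure (Fin n → X)) (hν : IsErgodicJoining μ T ν)
    (hpi : ν ≠ Measure.pi fun _ => μ) : ∃ i j : Fin n, i < j ∧ p (face ν i j) := by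
  have hdeg : ¬ p (μ.prod μ) := by
    intro h
    obtain ⟨q, r, hq, -⟩ := hp _ h
    obtain ⟨a, ha⟩ := exists_ae_eq_of_hasUniformFibres_prod hwm hq
    exact hpi (hν.toIsJoining.eq_pi_of_ae_eq ha)
  have hHI : HasHI μ T := IsQuasiSimple.hasHI hT hwm fun ν hν hpi => by
    obtain ⟨i, j, hij, h⟩ := h3 ν hν hpi
    exact ⟨i, j, hij, hp _ h⟩
  -- After an independent third coordinate is adjoined, the two new faces are `μ ⊗ μ`, so the face
  -- supplied by order three is the original one.
  have h2 : ∀ ν : Measure (Fin 2 → X), IsErgodicJoining μ T ν →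
      ν ≠ Measure.pi (fun _ => μ) → p (face ν 0 1) := by
    intro ν hν hpi
    obtain ⟨η, hη, h01, h02, h12, hres⟩ := hν.exists_prod hT hwm
    have hηpi : η ≠ Measure.pi fun _ => μ := by
      rintro rfl
      exact hpi (by rw [← hres, pi_reindex_castSucc])
    obtain ⟨i, j, hij, h⟩ := h3 η hη hηpi
    fin_cases i <;> fin_cases j <;> simp at hij
    · exact h01 ▸ h
    · exact absurd (h02 ▸ h) hdeg
    · exact absurd (h12 ▸ h) hdeg
  by_contra! hcon
  obtain ⟨n, rfl⟩ : ∃ k, n = k + 1 := ⟨n - 1, by omega⟩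
  -- If no face has the property, every face is a product by the case of order two, and HI makes the
  -- whole joining a product.
  refine hpi (hHI.eq_pi hT hwm n hν.toIsJoining fun i j hij => ?_)
  have hred := hν.reindex T.measurable ![i, j]
  have hface : face (ν.map fun x k => x ((![i, j] : Fin 2 → Fin (n + 1)) k)) 0 1 = face ν i j :=
    face_reindex ν _ 0 1
  by_cases hprod : (ν.map fun x k => x ((![i, j] : Fin 2 → Fin (n + 1)) k)) =
      Measure.pi fun _ => μ
  · rw [← hface, hprod]
    exact (measurePreserving_finTwoArrow μ).map_eq
  · exact absurd (hface ▸ h2 _ hred hprod) (hcon i j hij)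

end Joinings

end ErgodicJoinings

theorem mainTheorem6 {X : Type*} [MeasurableSpace X] [StandardBorelSpace X]
    (μ : MeasureTheory.Measure X) [MeasureTheory.IsProbabilityMeasure μ]
    (T : X ≃ᵐ X) (hT : MeasureTheory.MeasurePreserving T μ μ)
    (hwm : ErgodicJoinings.IsWeaklyMixing μ T) :
    (ErgodicJoinings.HasHI μ T → ErgodicJoinings.IsTensorSimple μ T) ∧
    (ErgodicJoinings.IsQuasiSimple μ T 3 → ErgodicJoinings.HasHI μ T) ∧
    (ErgodicJoinings.IsQuasiSimple μ T 3 ↔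
      ∀ n : ℕ, 2 ≤ n → ErgodicJoinings.IsQuasiSimple μ T n) ∧
    (ErgodicJoinings.IsSimpleOfOrder μ T 3 →
      ∀ n : ℕ, 2 ≤ n → ErgodicJoinings.IsSimpleOfOrder μ T n) :=
  ⟨fun h => h.isTensorSimple hT hwm, fun h => h.hasHI hT hwm,
    ⟨fun h _ hn => ErgodicJoinings.exists_face_of_three hT hwm (fun _ h => h) h hn,
      fun h => h 3 (by norm_num)⟩,
    fun h _ hn => ErgodicJoinings.exists_face_of_three hT hwm
      (fun _ h => h.isQuasiDiagonal) h hn⟩
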